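/- Let $X$ be a discrete set and $m:X\to(0,\infty)$; for $1\le p<\infty$ let $\ell^p=\ell^p(X,m)$ be the space of all $f:X\to\mathbb C$ with $\|f\|_p^p=\sum_{x}m(x)|f(x)|^p<\infty$, and write $\langle f,g\rangle=\sum_x m(x)f(x)\overline{g(x)}$ on $\ell^2$. Let $(b,o,c)$ be a magnetic Schrödinger graph over $(X,m)$, i.e. $b:X\times X\to[0,\infty)$ is symmetric with zero diagonal and $\sum_y b(x,y)<\infty$ for all $x$; $o:X\times X\to\{z\in\mathbb C: |z|=1\}$ satisfies $o(x,y)=\overline{o(y,x)}$; and $c:X\to\mathbb R$. For finitely supported $\varphi,\psi\in C_c(X)$ let $$Q(\varphi,\psi)=\frac12\sum_{x,y\in X}b(x,y)\bigl(\varphi(x)-o(x,y)\varphi(y)\bigr)\overline{\bigl(\psi(x)-o(x,y)\psi(y)\bigr)}+\sum_{x\in X}c(x)\varphi(x)\overline{\psi(x)},\qquad Q(\varphi)=Q(\varphi,\varphi),$$ and assume that $Q(\varphi)\ge 0$ for all $\varphi\in C_c(X)$. Assume that $c$ is form bounded with bounds $M>0$ and $C\ge0$, i.e., with $c_-=-(c\wedge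 0)$, $$\bigl\|\sqrt{c_- /m}\,\varphi\bigr\|_2^2\le M\,Q(\varphi)+C\,\|\varphi\|_2^2\qquad\text{for all }\varphi\in C_c(X).$$ (Then $Q$ is closable in $\ell^2$.) Let $H$ be the positive self-adjoint operator on $\ell^2$ associated with the closure of $Q$, let $\lambda_2=\inf\sigma(H)$ be the bottom of its spectrum, and let $S_2(t)=e^{-tH}$, $t\ge0$. **Theorem.** Let $$p\in\Bigl[2\tfrac{M+1}{M}-2\tfrac{\sqrt{M+1}}{M},\;2\tfrac{M+1}{M}+2\tfrac{\sqrt{M+1}}{M}\Bigr],\qquad C_p=4\,\frac{p-1}{p^2},\qquad D_p=\bigl(C_p-M(1-C_p)\bigr)\lambda_2-C(1-C_p).$$ Then $p\ge 1$, and for all $t\ge0$ and all $f\in\ell^2\cap\ell^p$ one has $S_2(t)f\in\ell^p$ and $$\|S_2(t)f\|_p\le e^{-D_pt}\,\|f\|_p .$$ Moreover, $S_2$ extends consistently to a strongly continuous semigroup on $\ell^p$ with the same bound: there is exactly one strongly continuous semigroup $(S_p(t))_{t\ge0}$ of bounded operators on $\ell^p$ such that $\|S_p(t)\|_{p,p}\le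 e^{-D_pt}$ for all $t\ge 0$ and $S_p(t)f=S_2(t)f$ for all $t\ge0$ and $f\in\ell^2\cap\ell^p$. -/

import Mathlib

open MeasureTheory Filter Topology
open scoped ENNReal NNReal ComplexConjugate

noncomputable section

/-! ### Unbounded operators on a Hilbert space -/

section Operators

variable {E : Type*} [NormedAddCommGroup E] [NormedSpace ℂ E]

/-- The bounded operator `R` is the two-sided inverse of `A - z : D(A) → E`. -/
def IsResolventAt (A : E →ₗ.[ℂ] E) (z : ℂ) (R : E →L[ℂ] E) : Prop :=
  (∀ y : E, ∃ hy : R y ∈ A.domain, A ⟨R y, hy⟩ - z • R y = y) ∧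
    ∀ x : A.domain, R (A x - z • (x : E)) = x

/-- The spectrum of an unbounded operator: all `z` for which `A - z : D(A) → E` has no bounded
inverse. -/
def pmapSpectrum (A : E →ₗ.[ℂ] E) : Set ℂ :=
  {z | ¬ ∃ R : E →L[ℂ] E, IsResolventAt A z R}

/-- The bottom `inf σ(A)` of the spectrum (for operators with real spectrum bounded below). -/
def spectralBottom (A : E →ₗ.[ℂ] E) : ℝ :=
  sInf {x : ℝ | (x : ℂ) ∈ pmapSpectrum A}

open scoped Classical in
/-- The resolvent `(A - z)⁻¹` as a bounded operator (`0` if `z` is in the spectrum). -/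
def pmapResolvent (A : E →ₗ.[ℂ] E) (z : ℂ) : E →L[ℂ] E :=
  if h : ∃ R : E →L[ℂ] E, IsResolventAt A z R then h.choose else 0

/-- A strongly continuous one-parameter semigroup of bounded operators. -/
structure IsC0Semigroup (T : ℝ≥0 → E →L[ℂ] E) : Prop where
  zero : T 0 = ContinuousLinearMap.id ℂ E
  add : ∀ s t, T (s + t) = (T s).comp (T t)
  continuous : ∀ f, Continuous fun t => T t f

/-- The function with `expProfile t (1 / (1 + a)) = exp (-t a)` for `a ≥ 0`, and for `t > 0` with
the limiting value `0` at the point `0` (which corresponds to `a = ∞`). It is continuous on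
`[0, 1]` for every `t ≥ 0`. -/
def expProfile (t r : ℝ) : ℝ :=
  if r = 0 ∧ t ≠ 0 then 0 else Real.exp (-t * (r⁻¹ - 1))

/-- `exp (-t A)` for a positive self-adjoint operator `A` on a Hilbert space, by the spectral
calculus: the resolvent `R = (A + 1)⁻¹` is a bounded self-adjoint operator with spectrum in `[0, 1]`
and `exp (-t A) = g (R)` for the continuous function `g` on `[0, 1]` with
`g (1 / (1 + a)) = exp (-t a)`. -/
def expNeg {F : Type*} [NormedAddCommGroup F] [InnerProductSpace ℂ F] [CompleteSpace F]
    (A : F →ₗ.[ℂ] F) (t : ℝ≥0) : F →L[ℂ] F :=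
  cfc (expProfile (t : ℝ)) (pmapResolvent A (-1))

end Operators

/-! ### Magnetic Schrödinger graphs -/

/-- A magnetic Schrödinger graph `(b, o, c)` over a discrete measure space `(X, m)`. -/
structure MagneticSchrodingerGraph (X : Type*) where
  /-- the weights of the measure -/
  m : X → ℝ
  m_pos : ∀ x, 0 < m x
  /-- the edge weights -/
  b : X → X → ℝ
  b_nonneg : ∀ x y, 0 ≤ b x y
  b_symm : ∀ x y, b x y = b y x
  b_diag : ∀ x, b x x = 0
  b_summable : ∀ x, Summable (b x)
  /-- the magnetic potential -/
  o : X → X → ℂ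
  o_norm : ∀ x y, ‖o x y‖ = 1
  o_conj : ∀ x y, o x y = conj (o y x)
  /-- the electric potential -/
  c : X → ℝ

namespace MagneticSchrodingerGraph

variable {X : Type*} (G : MagneticSchrodingerGraph X)

/-- The measure `m(A) = ∑_{x ∈ A} m(x)` on the power set of `X`. -/
def measure : @Measure X ⊤ :=
  letI : MeasurableSpace X := ⊤
  Measure.sum fun x => ENNReal.ofReal (G.m x) • Measure.dirac x

/-- The space `ℓ^p(X, m)`; as every point has positive measure, its elements are functions. -/
abbrev ell (p : ℝ≥0∞) := Lp ℂ p G.measure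

theorem memLp_finsupp (φ : X →₀ ℂ) (p : ℝ≥0∞) : MemLp (⇑φ) p G.measure := by
  classical
  let _ : MeasurableSpace X := ⊤
  induction φ using Finsupp.induction_linear with
  | zero => exact MemLp.zero'
  | add f g hf hg => rw [Finsupp.coe_add]; exact hf.add hg
  | single a z =>
    have h : ⇑(Finsupp.single a z) = Set.indicator {a} (fun _ => z) := by
      ext y
      by_cases hy : y = a
      · subst hy; simp
      · simp [hy]
    rw [h]
    refine memLp_indicator_const p (MeasurableSet.singleton a) z (Or.inr ?_)
    have hsum : ∑' x, ENNReal.ofReal (G.m x) * Set.indicator {a} (1 : X → ℝ≥0∞) x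
        = ENNReal.ofReal (G.m a) := by
      rw [tsum_eq_single a]
      · simp
      · intro y hy; simp [hy]
    simp only [measure]
    rw [Measure.sum_apply _ (MeasurableSet.singleton a)]
    simp only [Measure.smul_apply, smul_eq_mul, Measure.dirac_apply]
    rw [hsum]
    exact ENNReal.ofReal_ne_top

/-- The inclusion of the finitely supported functions `C_c(X)` into `ℓ²(X, m)`. -/
def toEll2 : (X →₀ ℂ) →ₗ[ℂ] G.ell 2 where
  toFun φ := (G.memLp_finsupp φ 2).toLp φ
  map_add' _ _ := rfl
  map_smul' _ _ := rfl

/-- The magnetic gradient `f(x) - o(x, y) f(y)`. -/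
def grad (f : X → ℂ) (x y : X) : ℂ := f x - G.o x y * f y

/-- The sesquilinear form
`Q(φ, ψ) = 1/2 ∑_{x, y} b(x, y) ∇φ(x, y) conj ∇ψ(x, y) + ∑_x c(x) φ(x) conj ψ(x)` on `C_c(X)`. -/
def form (φ ψ : X →₀ ℂ) : ℂ :=
  (1 / 2) * ∑' z : X × X, (G.b z.1 z.2 : ℂ) * (G.grad φ z.1 z.2 * conj (G.grad ψ z.1 z.2)) +
    ∑' x, (G.c x : ℂ) * (φ x * conj (ψ x))

/-- The (real) value `Q(φ) = Q(φ, φ)` of the quadratic form. -/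
def energy (φ : X →₀ ℂ) : ℝ := (G.form φ φ).re

/-- `Q` is positive. -/
def IsPositive : Prop := ∀ φ, 0 ≤ G.energy φ

/-- The negative part `c₋ = -(c ∧ 0)` of the potential. -/
def cNeg (x : X) : ℝ := -min (G.c x) 0

/-- The potential is form bounded with bounds `M` and `C`:
`‖√(c₋ / m) φ‖₂² ≤ M Q(φ) + C ‖φ‖₂²` for all `φ ∈ C_c(X)`. -/
def IsFormBounded (M C : ℝ) : Prop :=
  ∀ φ : X →₀ ℂ, ∑' x, G.m x * ‖(√(G.cNeg x / G.m x) : ℂ) * φ x‖ ^ 2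
    ≤ M * G.energy φ + C * ‖G.toEll2 φ‖ ^ 2

theorem summable_sq (φ : X →₀ ℂ) :
    Summable fun z : X × X => G.b z.1 z.2 * ‖φ z.1‖ ^ 2 := by
  have hnn : 0 ≤ fun z : X × X => G.b z.1 z.2 * ‖φ z.1‖ ^ 2 :=
    fun z => mul_nonneg (G.b_nonneg _ _) (sq_nonneg _)
  have h1 : ∀ x, Summable fun y => G.b x y * ‖φ x‖ ^ 2 :=
    fun x => (G.b_summable x).mul_right (‖φ x‖ ^ 2)
  have h2 : Summable fun x => ∑' y, G.b x y * ‖φ x‖ ^ 2 := by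
    refine summable_of_ne_finset_zero (s := φ.support) fun x hx => ?_
    simp [Finsupp.notMem_support_iff.mp hx]
  exact (summable_prod_of_nonneg hnn).mpr ⟨h1, h2⟩

theorem summable_sq' (φ : X →₀ ℂ) :
    Summable fun z : X × X => G.b z.1 z.2 * ‖φ z.2‖ ^ 2 := by
  refine ((Equiv.prodComm X X).summable_iff.mpr (G.summable_sq φ)).congr fun z => ?_
  simp [G.b_symm z.1 z.2]

theorem summable_form (φ ψ : X →₀ ℂ) : Summable fun z : X × X =>
    (G.b z.1 z.2 : ℂ) * (G.grad φ z.1 z.2 * conj (G.grad ψ z.1 z.2)) := by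
  classical
  have hg : ∀ (φ : X →₀ ℂ) (x y : X), ‖G.grad φ x y‖ ≤ ‖φ x‖ + ‖φ y‖ := by
    intro φ x y
    refine (norm_sub_le _ _).trans ?_
    simp [G.o_norm]
  have hS := ((G.summable_sq φ).add (G.summable_sq' φ)).add
    ((G.summable_sq ψ).add (G.summable_sq' ψ))
  refine Summable.of_norm_bounded hS fun z => ?_
  have h1 := hg φ z.1 z.2
  have h2 := hg ψ z.1 z.2
  rw [norm_mul, norm_mul, RCLike.norm_conj, Complex.norm_real, Real.norm_of_nonneg (G.b_nonneg _ _)]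
  have h3 : ‖G.grad φ z.1 z.2‖ * ‖G.grad ψ z.1 z.2‖
      ≤ (‖φ z.1‖ ^ 2 + ‖φ z.2‖ ^ 2) + (‖ψ z.1‖ ^ 2 + ‖ψ z.2‖ ^ 2) := by
    have := mul_le_mul h1 h2 (norm_nonneg _) (by positivity)
    nlinarith [sq_nonneg (‖φ z.1‖ + ‖φ z.2‖ - ‖ψ z.1‖ - ‖ψ z.2‖),
      sq_nonneg (‖φ z.1‖ - ‖φ z.2‖), sq_nonneg (‖ψ z.1‖ - ‖ψ z.2‖)]
  have := mul_le_mul_of_nonneg_left h3 (G.b_nonneg z.1 z.2)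
  simp only [mul_add] at this ⊢
  exact this

theorem summable_pot (φ ψ : X →₀ ℂ) :
    Summable fun x => (G.c x : ℂ) * (φ x * conj (ψ x)) := by
  classical
  refine summable_of_ne_finset_zero (s := φ.support) fun x hx => ?_
  simp [Finsupp.notMem_support_iff.mp hx]

theorem form_add_left (φ φ' ψ : X →₀ ℂ) :
    G.form (φ + φ') ψ = G.form φ ψ + G.form φ' ψ := by
  have h1 := (G.summable_form φ ψ).tsum_add (G.summable_form φ' ψ)
  have h2 := (G.summable_pot φ ψ).tsum_add (G.summable_pot φ' ψ)
  have e1 : (fun z : X × X => (G.b z.1 z.2 : ℂ) *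
        (G.grad ⇑(φ + φ') z.1 z.2 * conj (G.grad ψ z.1 z.2)))
      = fun z => (G.b z.1 z.2 : ℂ) * (G.grad φ z.1 z.2 * conj (G.grad ψ z.1 z.2)) +
        (G.b z.1 z.2 : ℂ) * (G.grad φ' z.1 z.2 * conj (G.grad ψ z.1 z.2)) := by
    ext z; simp only [grad, Finsupp.add_apply]; ring
  have e2 : (fun x => (G.c x : ℂ) * ((φ + φ') x * conj (ψ x)))
      = fun x => (G.c x : ℂ) * (φ x * conj (ψ x)) + (G.c x : ℂ) * (φ' x * conj (ψ x)) := by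
    ext z; simp only [Finsupp.add_apply]; ring
  rw [form, e1, e2, h1, h2, form, form]
  ring

theorem form_smul_left (a : ℂ) (φ ψ : X →₀ ℂ) :
    G.form (a • φ) ψ = a * G.form φ ψ := by
  have e1 : (fun z : X × X => (G.b z.1 z.2 : ℂ) *
        (G.grad ⇑(a • φ) z.1 z.2 * conj (G.grad ψ z.1 z.2)))
      = fun z => a * ((G.b z.1 z.2 : ℂ) * (G.grad φ z.1 z.2 * conj (G.grad ψ z.1 z.2))) := by
    ext z; simp only [grad, Finsupp.smul_apply, smul_eq_mul]; ring
  have e2 : (fun x => (G.c x : ℂ) * ((a • φ) x * conj (ψ x)))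
      = fun x => a * ((G.c x : ℂ) * (φ x * conj (ψ x))) := by
    ext z; simp only [Finsupp.smul_apply, smul_eq_mul]; ring
  rw [form, e1, e2, tsum_mul_left, tsum_mul_left, form]
  ring

theorem conj_form (φ ψ : X →₀ ℂ) : conj (G.form φ ψ) = G.form ψ φ := by
  rw [form, map_add, map_mul, Complex.conj_tsum, Complex.conj_tsum, form]
  congr 1
  · congr 1
    · simp [Complex.conj_ofNat]
    · refine tsum_congr fun z => ?_
      simp only [map_mul, Complex.conj_ofReal, Complex.conj_conj]
      ring
  · refine tsum_congr fun z => ?_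
    simp only [map_mul, Complex.conj_ofReal, Complex.conj_conj]
    ring

theorem energy_smul (a : ℂ) (φ : X →₀ ℂ) : G.energy (a • φ) = ‖a‖ ^ 2 * G.energy φ := by
  have h : G.form (a • φ) (a • φ) = ((‖a‖ ^ 2 : ℝ) : ℂ) * G.form φ φ := by
    rw [G.form_smul_left, ← G.conj_form, G.form_smul_left, map_mul, G.conj_form, ← mul_assoc,
      Complex.mul_conj, Complex.normSq_eq_norm_sq]
  rw [energy, h, Complex.re_ofReal_mul, energy]

theorem energy_add_le (hG : G.IsPositive) (φ ψ : X →₀ ℂ) :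
    G.energy (φ + ψ) ≤ 2 * G.energy φ + 2 * G.energy ψ := by
  have add_right : ∀ a b c : X →₀ ℂ, G.form a (b + c) = G.form a b + G.form a c := by
    intro a b c
    rw [← G.conj_form, G.form_add_left, map_add, G.conj_form, G.conj_form]
  have h : ∀ ψ : X →₀ ℂ, G.energy (φ + ψ)
      = G.energy φ + (G.form φ ψ).re + (G.form ψ φ).re + G.energy ψ := by
    intro ψ
    simp only [energy, G.form_add_left, add_right, Complex.add_re]
    ring
  have h1 := h ψ
  have h2 := h ((-1 : ℂ) • ψ)
  have h3 := hG (φ + (-1 : ℂ) • ψ)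
  have h4 : G.form φ ((-1 : ℂ) • ψ) = -G.form φ ψ := by
    rw [← G.conj_form, G.form_smul_left, map_mul, G.conj_form]; simp
  rw [h4, G.form_smul_left, G.energy_smul] at h2
  simp only [norm_neg, norm_one, one_pow, one_mul, neg_mul, Complex.neg_re] at h2
  linarith

/-- The sequence `φ` in `C_c(X)` converges to `f` in `ℓ²` and is Cauchy with respect to `Q`.
The domain `D(Q)` of the closure of `Q` is the set of all `f` that admit such a sequence, and the
closure is given by `Q(f, g) = lim Q(φₙ, ψₙ)`. -/
def IsApprox (f : G.ell 2) (φ : ℕ → X →₀ ℂ) : Prop :=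
  Tendsto (fun n => G.toEll2 (φ n)) atTop (𝓝 f) ∧
    Tendsto (fun k : ℕ × ℕ => G.energy (φ k.1 - φ k.2)) atTop (𝓝 0)

variable {G} in
theorem IsApprox.add (hG : G.IsPositive) {f g : G.ell 2} {φ ψ : ℕ → X →₀ ℂ}
    (hf : G.IsApprox f φ) (hg : G.IsApprox g ψ) :
    G.IsApprox (f + g) fun n => φ n + ψ n := by
  refine ⟨?_, ?_⟩
  · simpa only [map_add] using hf.1.add hg.1
  · have h := (hf.2.const_mul 2).add (hg.2.const_mul 2)
    simp only [mul_zero, add_zero] at h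
    refine squeeze_zero (fun k => hG _) (fun k => ?_) h
    rw [add_sub_add_comm]
    exact G.energy_add_le hG _ _

variable {G} in
theorem IsApprox.smul (a : ℂ) {f : G.ell 2} {φ : ℕ → X →₀ ℂ} (hf : G.IsApprox f φ) :
    G.IsApprox (a • f) fun n => a • φ n := by
  refine ⟨?_, ?_⟩
  · simpa only [map_smul] using hf.1.const_smul a
  · have h := hf.2.const_mul (‖a‖ ^ 2)
    rw [mul_zero] at h
    refine h.congr fun k => ?_
    rw [← smul_sub, G.energy_smul]

/-- The graph of the operator associated with the closure of `Q`: all pairs `(f, h)` with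
`f ∈ D(Q)` and `Q(f, g) = ⟨h, g⟩` for all `g ∈ D(Q)`. Mathlib's `inner ℂ g h` is linear in `h`, so it
is the product `⟨h, g⟩ = ∑ m h conj g`. -/
def opGraph (hG : G.IsPositive) : Submodule ℂ (G.ell 2 × G.ell 2) where
  carrier := {u | ∃ φ, G.IsApprox u.1 φ ∧ ∀ g ψ, G.IsApprox g ψ →
    Tendsto (fun n => G.form (φ n) (ψ n)) atTop (𝓝 (inner ℂ g u.2))}
  zero_mem' := by
    have h0 : G.energy 0 = 0 := by simpa using G.energy_smul 0 0
    refine ⟨fun _ => 0, ⟨?_, ?_⟩, fun g ψ _ => ?_⟩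
    · simp only [map_zero]; exact tendsto_const_nhds
    · simp only [sub_zero, h0]; exact tendsto_const_nhds
    · have h1 : ∀ χ, G.form 0 χ = 0 := fun χ => by simpa using G.form_smul_left 0 0 χ
      simp [h1]
  add_mem' := by
    rintro u v ⟨φ, hφ, hφ'⟩ ⟨ψ, hψ, hψ'⟩
    refine ⟨fun n => φ n + ψ n, hφ.add hG hψ, fun g χ hχ => ?_⟩
    simp only [Prod.snd_add, inner_add_right, G.form_add_left]
    exact (hφ' g χ hχ).add (hψ' g χ hχ)
  smul_mem' := by
    rintro a u ⟨φ, hφ, hφ'⟩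
    refine ⟨fun n => a • φ n, hφ.smul a, fun g χ hχ => ?_⟩
    simp only [Prod.smul_snd, inner_smul_right, G.form_smul_left]
    exact (hφ' g χ hχ).const_mul a

/-- The positive self-adjoint operator `H` on `ℓ²(X, m)` associated with the closure of `Q`, for
positive and closable `Q`. -/
def H (hG : G.IsPositive) : G.ell 2 →ₗ.[ℂ] G.ell 2 := (G.opGraph hG).toLinearPMap

/-- The bottom `λ₂ = inf σ(H)` of the `ℓ²`-spectrum. -/
def lam2 (hG : G.IsPositive) : ℝ := spectralBottom (G.H hG)

/-- The magnetic Schrödinger semigroup `S₂(t) = exp (-t H)` on `ℓ²(X, m)`. -/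
def S2 (hG : G.IsPositive) (t : ℝ≥0) : G.ell 2 →L[ℂ] G.ell 2 := expNeg (G.H hG) t

end MagneticSchrodingerGraph

/-- The constant `C_p = 4 (p - 1) / p²`. -/
def Cconst (p : ℝ) : ℝ := 4 * ((p - 1) / p ^ 2)

/-- The rate `D_p = (C_p - M (1 - C_p)) λ - C (1 - C_p)`. -/
def Dconst (M C lam p : ℝ) : ℝ :=
  (Cconst p - M * (1 - Cconst p)) * lam - C * (1 - Cconst p)

end

noncomputable section

namespace MagneticSchrodingerGraph

variable {X : Type*} (G : MagneticSchrodingerGraph X)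

/-! ### The spaces `ℓ^p(X, m)` -/

/-! The heart is the lower bound Re Q(φ, φ|φ|^{p-2}) ≥ D_p ‖φ‖_p^p for finitely supported φ
(`Dconst_mul_sum_le`). With v = φ|φ|^{p/2-1}, a pointwise inequality for complex numbers
(`Cconst_mul_norm_sq_le`) bounds the kinetic part from below by C_p times that of v, and the
potential parts of (φ, φ|φ|^{p-2}) and of v coincide. Hence the left side is at least C_p Q(v) + (1
- C_p) ∑ c|v|², and form boundedness turns this into (C_p - M(1 - C_p)) Q(v) - C(1 - C_p)‖v‖². The
interval for p is exactly where the coefficient of Q(v) is nonnegative, so Q(v) ≥ λ₂‖v‖² may be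
inserted; finally ‖v‖² = ‖φ‖_p^p.

The bound passes to the resolvent by a Galerkin scheme (`exists_galerkin`): the solutions u_K of the
weak equation on finite sets K are finitely supported, so u_K|u_K|^{p-2} is an admissible test
function, and Hölder gives ‖u_K‖_p ≤ ‖f‖_p / (a + D_p). They converge to (H + a)⁻¹f in ℓ², hence
pointwise, and the ℓ^p-norm is lower semicontinuous (`eLpNorm_resolvent_le`). The Euler formula
e^{-tH} = lim ((n/t)(H + n/t)⁻¹)ⁿ then yields the rate e^{-D_p t} (`eLpNorm_S2_le`).

The operator enters only through its resolvent J J*, where J maps the abstract completion of C_c(X)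
under Q + a⟨·,·⟩ into ℓ². Injectivity of J plays no role: the density of its range makes J J*
injective, and the graph of H is {(f, h) : J J*(h + a f) = f}.

The extension to ℓ^p is by density. Strong continuity follows from pointwise convergence combined
with norm bounds tending to the norm of the limit (`tendsto_toEll_of_pointwise`). -/

theorem measure_singleton (a : X) : G.measure {a} = ENNReal.ofReal (G.m a) := by
  classical
  let _ : MeasurableSpace X := ⊤
  rw [measure, Measure.sum_apply _ (MeasurableSet.singleton a), tsum_eq_single a]
  · simp
  · intro y hy; simp [hy]

/-- Every point has positive mass, so the only null set is empty. This allows classes in ℓ^p to be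
handled as functions. -/
theorem ae_iff_forall {P : X → Prop} : (∀ᵐ x ∂G.measure, P x) ↔ ∀ x, P x := by
  refine ⟨fun h x => ?_, fun h => Eventually.of_forall h⟩
  by_contra hx
  have h0 : G.measure {x} = 0 := measure_mono_null (by simpa using hx) (ae_iff.mp h)
  rw [measure_singleton, ENNReal.ofReal_eq_zero] at h0
  exact h0.not_gt (G.m_pos x)

theorem ae_eq_iff {f g : X → ℂ} : f =ᵐ[G.measure] g ↔ f = g := by
  rw [EventuallyEq, ae_iff_forall, funext_iff]

theorem ell_ext {p : ℝ≥0∞} {f g : G.ell p} (h : (f : X → ℂ) = g) : f = g :=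
  Lp.ext (G.ae_eq_iff.mpr h)

theorem coeFn_toLp {p : ℝ≥0∞} {f : X → ℂ} (hf : MemLp f p G.measure) :
    (hf.toLp f : X → ℂ) = f := G.ae_eq_iff.mp hf.coeFn_toLp

theorem coeFn_add {p : ℝ≥0∞} (f g : G.ell p) : ((f + g : G.ell p) : X → ℂ) = f + g :=
  G.ae_eq_iff.mp (Lp.coeFn_add f g)

theorem coeFn_sub {p : ℝ≥0∞} (f g : G.ell p) : ((f - g : G.ell p) : X → ℂ) = f - g :=
  G.ae_eq_iff.mp (Lp.coeFn_sub f g)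

theorem coeFn_smul {p : ℝ≥0∞} (a : ℂ) (f : G.ell p) : ((a • f : G.ell p) : X → ℂ) = a • ⇑f :=
  G.ae_eq_iff.mp (Lp.coeFn_smul a f)

theorem coeFn_zero (p : ℝ≥0∞) : ((0 : G.ell p) : X → ℂ) = 0 :=
  G.ae_eq_iff.mp (Lp.coeFn_zero ℂ p G.measure)

theorem aestronglyMeasurable_measure (f : X → ℂ) :
    @AEStronglyMeasurable X ℂ _ ⊤ ⊤ f G.measure := by
  let _ : MeasurableSpace X := ⊤
  exact (measurable_from_top (f := f)).aestronglyMeasurable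

theorem lintegral_measure (g : X → ℝ≥0∞) :
    ∫⁻ x, g x ∂G.measure = ∑' x, ENNReal.ofReal (G.m x) * g x := by
  let _ : MeasurableSpace X := ⊤
  rw [measure, lintegral_sum_measure]
  refine tsum_congr fun x => ?_
  rw [lintegral_smul_measure, lintegral_dirac' x measurable_from_top, smul_eq_mul]

theorem eLpNorm_rpow {p : ℝ} (hp : 1 ≤ p) (f : X → ℂ) :
    eLpNorm f (ENNReal.ofReal p) G.measure ^ p
      = ∑' x, ENNReal.ofReal (G.m x * ‖f x‖ ^ p) := by
  have hp0 : 0 < p := by linarith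
  rw [eLpNorm_eq_lintegral_rpow_enorm_toReal (by simpa using hp0) ENNReal.ofReal_ne_top,
    ENNReal.toReal_ofReal hp0.le, ← ENNReal.rpow_mul, one_div, inv_mul_cancel₀ hp0.ne',
    ENNReal.rpow_one, lintegral_measure]
  refine tsum_congr fun x => ?_
  rw [ENNReal.ofReal_mul (G.m_pos x).le, ← ofReal_norm, ENNReal.ofReal_rpow_of_nonneg
    (norm_nonneg _) hp0.le]

/-- A bound of the `ℓ^p`-norm is a bound of all finite sums. -/
theorem eLpNorm_le_iff {p : ℝ} (hp : 1 ≤ p) (f : X → ℂ) {B : ℝ} (hB : 0 ≤ B) :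
    eLpNorm f (ENNReal.ofReal p) G.measure ≤ ENNReal.ofReal B ↔
      ∀ K : Finset X, ∑ x ∈ K, G.m x * ‖f x‖ ^ p ≤ B ^ p := by
  have hp0 : 0 < p := by linarith
  have hnn : ∀ x, 0 ≤ G.m x * ‖f x‖ ^ p := fun x =>
    mul_nonneg (G.m_pos x).le (Real.rpow_nonneg (norm_nonneg _) _)
  rw [← ENNReal.rpow_le_rpow_iff hp0, eLpNorm_rpow G hp,
    ENNReal.ofReal_rpow_of_nonneg hB hp0.le, ENNReal.tsum_eq_iSup_sum, iSup_le_iff]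
  refine forall_congr' fun K => ?_
  rw [← ENNReal.ofReal_sum_of_nonneg fun x _ => hnn x,
    ENNReal.ofReal_le_ofReal_iff (Real.rpow_nonneg hB _)]

theorem sum_le_eLpNorm {p : ℝ} (hp : 1 ≤ p) {f : X → ℂ}
    (hf : MemLp f (ENNReal.ofReal p) G.measure) (K : Finset X) :
    ∑ x ∈ K, G.m x * ‖f x‖ ^ p ≤ (eLpNorm f (ENNReal.ofReal p) G.measure).toReal ^ p :=
  (G.eLpNorm_le_iff hp f ENNReal.toReal_nonneg).mp
    (by rw [ENNReal.ofReal_toReal hf.2.ne]) K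

/-- The `ℓ^p`-norm is lower semicontinuous under pointwise convergence. -/
theorem eLpNorm_le_of_tendsto {ι : Type*} {l : Filter ι} [l.NeBot] {p : ℝ} (hp : 1 ≤ p)
    {g : ι → X → ℂ} {f : X → ℂ} (hg : ∀ x, Tendsto (fun i => g i x) l (𝓝 (f x)))
    {B : ι → ℝ} {b : ℝ} (hB : Tendsto B l (𝓝 b)) (hB0 : ∀ᶠ i in l, 0 ≤ B i)
    (h : ∀ᶠ i in l, eLpNorm (g i) (ENNReal.ofReal p) G.measure ≤ ENNReal.ofReal (B i)) :
    eLpNorm f (ENNReal.ofReal p) G.measure ≤ ENNReal.ofReal b := by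
  have hp0 : 0 ≤ p := by linarith
  have hb : 0 ≤ b := ge_of_tendsto hB hB0
  rw [G.eLpNorm_le_iff hp f hb]
  intro K
  have h1 : Tendsto (fun i => ∑ x ∈ K, G.m x * ‖g i x‖ ^ p) l
      (𝓝 (∑ x ∈ K, G.m x * ‖f x‖ ^ p)) :=
    tendsto_finsetSum _ fun x _ =>
      ((hg x).norm.rpow_const (Or.inr hp0)).const_mul _
  refine le_of_tendsto_of_tendsto h1 (hB.rpow_const (Or.inr hp0)) ?_
  filter_upwards [hB0, h] with i hi hi'
  exact (G.eLpNorm_le_iff hp _ hi).mp hi' K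

@[simp]
theorem coeFn_toEll2 (φ : X →₀ ℂ) : (G.toEll2 φ : X → ℂ) = φ :=
  G.coeFn_toLp (G.memLp_finsupp φ 2)

theorem inner_toEll2_single (a : X) (z : ℂ) (f : G.ell 2) :
    inner ℂ (G.toEll2 (Finsupp.single a z)) f = G.m a * (f a * conj z) := by
  classical
  let _ : MeasurableSpace X := ⊤
  have hμ : G.measure {a} ≠ ∞ := by rw [measure_singleton]; exact ENNReal.ofReal_ne_top
  have h : G.toEll2 (Finsupp.single a z)
      = indicatorConstLp 2 (MeasurableSet.singleton a) hμ z := by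
    refine G.ell_ext ?_
    rw [coeFn_toEll2, G.ae_eq_iff.mp indicatorConstLp_coeFn]
    ext y
    by_cases hy : y = a
    · subst hy; simp
    · simp [hy]
  rw [h, L2.inner_indicatorConstLp_eq_inner_setIntegral, integral_singleton, Measure.real,
    measure_singleton, ENNReal.toReal_ofReal (G.m_pos a).le]
  simp only [RCLike.inner_apply, Complex.real_smul]
  ring

theorem inner_toEll2 (φ : X →₀ ℂ) (f : G.ell 2) {K : Finset X} (hK : φ.support ⊆ K) :
    inner ℂ (G.toEll2 φ) f = ∑ x ∈ K, (G.m x : ℂ) * (f x * conj (φ x)) := by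
  conv_lhs => rw [← φ.sum_single, Finsupp.sum, map_sum, sum_inner]
  simp only [inner_toEll2_single]
  refine Finset.sum_subset hK fun x _ hx => ?_
  simp [Finsupp.notMem_support_iff.mp hx]

theorem norm_toEll2_sq (φ : X →₀ ℂ) {K : Finset X} (hK : φ.support ⊆ K) :
    ‖G.toEll2 φ‖ ^ 2 = ∑ x ∈ K, G.m x * ‖φ x‖ ^ 2 := by
  rw [← inner_self_eq_norm_sq (𝕜 := ℂ), G.inner_toEll2 φ _ hK, coeFn_toEll2, map_sum]
  refine Finset.sum_congr rfl fun x _ => ?_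
  rw [Complex.mul_conj, Complex.normSq_eq_norm_sq, ← Complex.ofReal_mul]
  exact Complex.ofReal_re _

/-- Up to the factor m(x), evaluation is the inner product with a point mass. Pointwise convergence
is the link from ℓ² limits to ℓ^p bounds. -/
theorem continuous_eval (x : X) : Continuous fun f : G.ell 2 => f x := by
  have h : (fun f : G.ell 2 => f x)
      = fun f => (G.m x : ℂ)⁻¹ * inner ℂ (G.toEll2 (Finsupp.single x 1)) f := by
    ext f
    have : (G.m x : ℂ) ≠ 0 := by exact_mod_cast (G.m_pos x).ne'
    rw [inner_toEll2_single, map_one, mul_one, inv_mul_cancel_left₀ this]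
  rw [h]
  fun_prop

theorem denseRange_toEll2 : DenseRange G.toEll2 := by
  have h : (LinearMap.range G.toEll2).topologicalClosure = ⊤ := by
    rw [Submodule.topologicalClosure_eq_top_iff, Submodule.eq_bot_iff]
    intro f hf
    refine G.ell_ext ?_
    rw [coeFn_zero]
    ext x
    have := (Submodule.mem_orthogonal _ _).mp hf _ ⟨Finsupp.single x 1, rfl⟩
    rw [inner_toEll2_single] at this
    simpa [(G.m_pos x).ne'] using this
  rw [DenseRange, ← LinearMap.coe_range]
  exact Submodule.dense_iff_topologicalClosure_eq_top.mpr h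

/-- The inclusion of the finitely supported functions into `ℓ^p`. -/
def toEll (p : ℝ≥0∞) (φ : X →₀ ℂ) : G.ell p := (G.memLp_finsupp φ p).toLp φ

@[simp]
theorem coeFn_toEll (p : ℝ≥0∞) (φ : X →₀ ℂ) : (G.toEll p φ : X → ℂ) = φ :=
  G.coeFn_toLp (G.memLp_finsupp φ p)

theorem norm_le_iff {p : ℝ} (hp : 1 ≤ p) (f : G.ell (ENNReal.ofReal p)) {B : ℝ} (hB : 0 ≤ B) :
    ‖f‖ ≤ B ↔ ∀ K : Finset X, ∑ x ∈ K, G.m x * ‖f x‖ ^ p ≤ B ^ p := by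
  rw [← G.eLpNorm_le_iff hp f hB, Lp.norm_def,
    ENNReal.le_ofReal_iff_toReal_le (Lp.memLp f).2.ne hB]

theorem denseRange_toEll {p : ℝ} (hp : 1 ≤ p) [Fact (1 ≤ ENNReal.ofReal p)] :
    DenseRange (G.toEll (ENNReal.ofReal p)) := by
  classical
  have hp0 : 0 < p := by linarith
  intro f
  rw [Metric.mem_closure_range_iff]
  intro ε hε
  have hs : Summable fun x => G.m x * ‖f x‖ ^ p :=
    summable_of_sum_le (fun x => mul_nonneg (G.m_pos x).le (Real.rpow_nonneg (norm_nonneg _) _))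
      (G.sum_le_eLpNorm hp (Lp.memLp f))
  -- Half of ε, because `norm_le_iff` yields only a non-strict inequality.
  have hε2 : 0 < (ε / 2) ^ p := by positivity
  obtain ⟨K, hK⟩ := summable_iff_vanishing_norm.mp hs _ hε2
  refine ⟨Finsupp.onFinset K (fun x => if x ∈ K then f x else 0) fun x hx => ?_, ?_⟩
  · by_contra h; simp [h] at hx
  · rw [dist_eq_norm]
    refine lt_of_le_of_lt ((G.norm_le_iff hp _ (half_pos hε).le).mpr fun L => ?_) (half_lt_self hε)
    have h1 := hK (L \ K) Finset.sdiff_disjoint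
    refine le_trans ?_ ((Real.le_norm_self _).trans h1.le)
    rw [← Finset.sum_sdiff (Finset.sdiff_subset (s := L) (t := K)), coeFn_sub, coeFn_toEll]
    rw [Finset.sum_congr (s₂ := L \ K) (g := fun x => G.m x * ‖f x‖ ^ p) rfl
      (by intro x hx; simp [(Finset.mem_sdiff.mp hx).2])]
    rw [Finset.sum_eq_zero (s := L \ (L \ K)), zero_add]
    intro x hx
    have : x ∈ K := by
      simp only [Finset.mem_sdiff] at hx; tauto
    simp [this, Real.zero_rpow hp0.ne']

end MagneticSchrodingerGraph

/-! ### Pointwise inequalities -/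

theorem Cconst_le_one {p : ℝ} (hp : 1 < p) : Cconst p ≤ 1 := by
  have : 0 < p ^ 2 := by positivity
  rw [Cconst, ← mul_div_assoc, div_le_one this]
  nlinarith [sq_nonneg (p - 2)]

/-- This is Cauchy–Schwarz, (∫ x^{p/2-1})² ≤ (s - r) ∫ x^{p-2} over [r, s], with monotonicity of an
antiderivative in place of integrals. -/
theorem Cconst_mul_sq_le_of_lt {p : ℝ} (hp : 1 < p) {r s : ℝ} (hr : 0 ≤ r) (hrs : r < s) :
    Cconst p * (s ^ (p / 2) - r ^ (p / 2)) ^ 2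
      ≤ (s - r) * (s ^ (p - 1) - r ^ (p - 1)) := by
  have hp1 : 0 < p - 1 := by linarith
  -- An antiderivative of (x^{p/2-1} - l)². It is continuous at 0 even if the derivative blows up
  -- there, so r = 0 is allowed.
  have hmono : ∀ l : ℝ, MonotoneOn
      (fun x : ℝ => x ^ (p - 1) / (p - 1) - 2 * l * (x ^ (p / 2) / (p / 2)) + l ^ 2 * x)
      (Set.Ici 0) := by
    intro l
    refine monotoneOn_of_hasDerivWithinAt_nonneg
      (f' := fun x => (x ^ (p / 2 - 1) - l) ^ 2) (convex_Ici 0) ?_ ?_ ?_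
    · have h1 : Continuous fun x : ℝ => x ^ (p - 1) := Real.continuous_rpow_const hp1.le
      have h2 : Continuous fun x : ℝ => x ^ (p / 2) := Real.continuous_rpow_const (by linarith)
      exact Continuous.continuousOn (by fun_prop)
    · intro x hx
      rw [interior_Ici] at hx
      have hx : 0 < x := hx
      have h1 := (Real.hasDerivAt_rpow_const (p := p - 1) (Or.inl hx.ne')).div_const (p - 1)
      have h2 := ((Real.hasDerivAt_rpow_const (p := p / 2) (Or.inl hx.ne')).div_const
        (p / 2)).const_mul (2 * l)
      have h3 := (hasDerivAt_id x).const_mul (l ^ 2)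
      refine (((h1.sub h2).add h3).congr_deriv ?_).hasDerivWithinAt
      have e : x ^ (p - 1 - 1) = (x ^ (p / 2 - 1)) ^ 2 := by
        rw [← Real.rpow_natCast, ← Real.rpow_mul hx.le]; congr 1; push_cast; ring
      rw [e]
      field_simp
      ring
    · intro x _; positivity
  have hB : 0 < s - r := sub_pos.mpr hrs
  set B := (s ^ (p / 2) - r ^ (p / 2)) / (p / 2) with hBdef
  set A := (s ^ (p - 1) - r ^ (p - 1)) / (p - 1) with hAdef
  -- The optimal l is the mean value of x^{p/2-1} on [r, s].
  have h := hmono (B / (s - r)) (Set.mem_Ici.mpr hr) (Set.mem_Ici.mpr (hr.trans hrs.le)) hrs.le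
  have h' : 0 ≤ A - 2 * (B / (s - r)) * B + (B / (s - r)) ^ 2 * (s - r) := by
    have e : A - 2 * (B / (s - r)) * B + (B / (s - r)) ^ 2 * (s - r)
      = (s ^ (p - 1) / (p - 1) - 2 * (B / (s - r)) * (s ^ (p / 2) / (p / 2)) +
          (B / (s - r)) ^ 2 * s) - (r ^ (p - 1) / (p - 1)
          - 2 * (B / (s - r)) * (r ^ (p / 2) / (p / 2)) + (B / (s - r)) ^ 2 * r) := by
      rw [hAdef]; generalize B / (s - r) = l; rw [hBdef]; ring
    rw [e]; linarith
  have h2 : B ^ 2 ≤ (s - r) * A := by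
    have e : A - 2 * (B / (s - r)) * B + (B / (s - r)) ^ 2 * (s - r)
      = ((s - r) * A - B ^ 2) / (s - r) := by field_simp; ring
    rw [e] at h'
    have := mul_nonneg h' hB.le
    rw [div_mul_cancel₀ _ hB.ne'] at this
    linarith
  have e1 : Cconst p * (s ^ (p / 2) - r ^ (p / 2)) ^ 2 = (p - 1) * B ^ 2 := by
    rw [hBdef, Cconst]; field_simp; ring
  have e2 : (s - r) * (s ^ (p - 1) - r ^ (p - 1)) = (p - 1) * ((s - r) * A) := by
    rw [hAdef]; field_simp
  rw [e1, e2]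
  exact mul_le_mul_of_nonneg_left h2 hp1.le

theorem Cconst_mul_sq_le {p : ℝ} (hp : 1 < p) {r s : ℝ} (hr : 0 ≤ r) (hs : 0 ≤ s) :
    Cconst p * (s ^ (p / 2) - r ^ (p / 2)) ^ 2
      ≤ (s - r) * (s ^ (p - 1) - r ^ (p - 1)) := by
  rcases lt_trichotomy r s with h | h | h
  · exact Cconst_mul_sq_le_of_lt hp hr h
  · subst h; simp
  · have := Cconst_mul_sq_le_of_lt hp hs h
    linarith [this]

/-- The function `z |z|^{q-1}`. -/
def signedPow (q : ℝ) (z : ℂ) : ℂ := (‖z‖ ^ (q - 1) : ℝ) * z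

@[simp]
theorem signedPow_zero (q : ℝ) : signedPow q 0 = 0 := by simp [signedPow]

theorem norm_signedPow {q : ℝ} (hq : 0 < q) (z : ℂ) : ‖signedPow q z‖ = ‖z‖ ^ q := by
  rcases eq_or_ne z 0 with rfl | hz
  · simp [Real.zero_rpow hq.ne']
  · have : 0 < ‖z‖ := norm_pos_iff.mpr hz
    rw [signedPow, norm_mul, Complex.norm_real, Real.norm_of_nonneg (by positivity),
      Real.rpow_sub_one this.ne', div_mul_cancel₀ _ this.ne']

/-- Phases pass through the power, so the magnetic potential can be absorbed into one argument of
the pointwise inequality. -/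
theorem signedPow_mul_of_norm_eq_one (q : ℝ) {u : ℂ} (hu : ‖u‖ = 1) (z : ℂ) :
    signedPow q (u * z) = u * signedPow q z := by
  simp only [signedPow, norm_mul, hu, one_mul]; ring

theorem mul_conj_signedPow {p : ℝ} (hp : 1 < p) (z : ℂ) :
    z * conj (signedPow (p - 1) z) = (‖z‖ ^ p : ℝ) := by
  rcases eq_or_ne z 0 with rfl | hz
  · simp [Real.zero_rpow (by linarith : p ≠ 0)]
  · have hz : 0 < ‖z‖ := norm_pos_iff.mpr hz
    rw [signedPow, map_mul, Complex.conj_ofReal, mul_left_comm, Complex.mul_conj,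
      Complex.normSq_eq_norm_sq, ← Complex.ofReal_mul, ← Real.rpow_natCast,
      ← Real.rpow_add hz]
    congr 2; push_cast; ring

/-- For fixed moduli both sides are affine in Re(a w̄) ≤ |a||w|. At the maximal value the claim is
the real inequality for |a| and |w|, and lowering Re(a w̄) only enlarges the difference of the two
sides. -/
theorem Cconst_mul_norm_sq_le {p : ℝ} (hp : 1 < p) (a w : ℂ) :
    Cconst p * ‖signedPow (p / 2) a - signedPow (p / 2) w‖ ^ 2
      ≤ ((a - w) * conj (signedPow (p - 1) a - signedPow (p - 1) w)).re := by
  have hC1 := Cconst_le_one hp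
  have hnorm : ∀ z : ℂ, ‖signedPow (p / 2) z‖ ^ 2 = ‖z‖ ^ p := by
    intro z
    rw [norm_signedPow (by linarith), ← Real.rpow_natCast, ← Real.rpow_mul (norm_nonneg _)]
    congr 1; push_cast; ring
  have hre : ∀ z : ℂ, (z * conj (signedPow (p - 1) z)).re = ‖z‖ ^ p := by
    intro z; rw [mul_conj_signedPow hp, Complex.ofReal_re]
  -- The exponents p/2 - 1 and p - 2 may be negative, so zero is treated apart; there C_p ≤ 1
  -- suffices.
  rcases eq_or_ne a 0 with rfl | ha
  · have := hre w
    have hn : 0 ≤ ‖w‖ ^ p := by positivity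
    simp only [signedPow_zero, zero_sub, norm_neg, hnorm, map_neg, neg_mul_neg, this]
    nlinarith
  rcases eq_or_ne w 0 with rfl | hw
  · have := hre a
    have hn : 0 ≤ ‖a‖ ^ p := by positivity
    simp only [signedPow_zero, sub_zero, hnorm, this]
    nlinarith
  have ha' : 0 < ‖a‖ := norm_pos_iff.mpr ha
  have hw' : 0 < ‖w‖ := norm_pos_iff.mpr hw
  have key := Cconst_mul_sq_le hp hw'.le ha'.le
  set A := ‖a‖ ^ (p / 2 - 1) with hA
  set B := ‖w‖ ^ (p / 2 - 1) with hB
  have hA0 : 0 < A := by positivity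
  have hB0 : 0 < B := by positivity
  have e1 : ∀ t : ℝ, 0 < t → t ^ (p - 1 - 1) = (t ^ (p / 2 - 1)) ^ 2 := by
    intro t ht
    rw [← Real.rpow_natCast, ← Real.rpow_mul ht.le]; congr 1; push_cast; ring
  have e2 : ∀ t : ℝ, 0 < t → t ^ (p - 1) = (t ^ (p / 2 - 1)) ^ 2 * t := by
    intro t ht
    rw [← e1 t ht, Real.rpow_sub_one ht.ne' (p - 1), div_mul_cancel₀ _ ht.ne']
  have e3 : ∀ t : ℝ, 0 < t → t ^ (p / 2) = t ^ (p / 2 - 1) * t := by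
    intro t ht
    rw [Real.rpow_sub_one ht.ne', div_mul_cancel₀ _ ht.ne']
  rw [e2 _ ha', e2 _ hw', e3 _ ha', e3 _ hw', ← hA, ← hB] at key
  have hc : (a * conj w).re ≤ ‖a‖ * ‖w‖ := by
    refine (Complex.re_le_norm _).trans ?_
    rw [norm_mul, RCLike.norm_conj]
  have hsa : ‖a‖ ^ 2 = a.re ^ 2 + a.im ^ 2 := by
    rw [← Complex.normSq_eq_norm_sq, Complex.normSq_apply]; ring
  have hsw : ‖w‖ ^ 2 = w.re ^ 2 + w.im ^ 2 := by
    rw [← Complex.normSq_eq_norm_sq, Complex.normSq_apply]; ring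
  have l1 : ‖signedPow (p / 2) a - signedPow (p / 2) w‖ ^ 2
      = A ^ 2 * ‖a‖ ^ 2 + B ^ 2 * ‖w‖ ^ 2 - 2 * A * B * (a * conj w).re := by
    rw [← Complex.normSq_eq_norm_sq, Complex.normSq_apply, hsa, hsw]
    simp only [signedPow, ← hA, ← hB, Complex.sub_re, Complex.sub_im, Complex.ofReal_re,
      Complex.ofReal_im, Complex.im_ofReal_mul, Complex.mul_re, Complex.conj_re, Complex.conj_im]
    ring
  have l2 : ((a - w) * conj (signedPow (p - 1) a - signedPow (p - 1) w)).re
      = A ^ 2 * ‖a‖ ^ 2 + B ^ 2 * ‖w‖ ^ 2 - (A ^ 2 + B ^ 2) * (a * conj w).re := by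
    rw [hsa, hsw]
    simp only [signedPow, e1 _ ha', e1 _ hw', ← hA, ← hB, Complex.sub_re, Complex.sub_im,
      Complex.ofReal_re, Complex.ofReal_im, map_sub, map_mul, Complex.conj_ofReal,
      Complex.im_ofReal_mul, Complex.mul_re, Complex.conj_re, Complex.conj_im]
    ring
  rw [l1, l2]
  -- Minus the slope, in Re(a w̄), of right side minus left side.
  have hslope : 0 ≤ A ^ 2 + B ^ 2 - 2 * Cconst p * (A * B) := by
    have : Cconst p * (A * B) ≤ 1 * (A * B) :=
      mul_le_mul_of_nonneg_right hC1 (by positivity)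
    nlinarith [sq_nonneg (A - B)]
  nlinarith [mul_le_mul_of_nonneg_left hc hslope]

namespace MagneticSchrodingerGraph

variable {X : Type*} (G : MagneticSchrodingerGraph X)

/-! ### The form inequality -/

/-- The finitely supported function `φ |φ|^{q-1}`. -/
def finsuppPow (q : ℝ) (φ : X →₀ ℂ) : X →₀ ℂ := φ.mapRange (signedPow q) (signedPow_zero q)

@[simp]
theorem finsuppPow_apply (q : ℝ) (φ : X →₀ ℂ) (x : X) : finsuppPow q φ x = signedPow q (φ x) := rfl

theorem support_finsuppPow (q : ℝ) (φ : X →₀ ℂ) : (finsuppPow q φ).support ⊆ φ.support :=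
  Finsupp.support_mapRange

theorem re_form (φ ψ : X →₀ ℂ) : (G.form φ ψ).re =
    (1 / 2) * ∑' z : X × X, G.b z.1 z.2 * (G.grad φ z.1 z.2 * conj (G.grad ψ z.1 z.2)).re +
      ∑' x, G.c x * (φ x * conj (ψ x)).re := by
  rw [form, Complex.add_re, Complex.re_tsum (G.summable_pot φ ψ)]
  congr 1
  · rw [show (1 / 2 : ℂ) = ((1 / 2 : ℝ) : ℂ) by norm_num, Complex.re_ofReal_mul,
      Complex.re_tsum (G.summable_form φ ψ)]
    simp only [Complex.re_ofReal_mul]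
  · simp only [Complex.re_ofReal_mul]

/-- With s = √(M + 1) and M = s² - 1 the endpoints become 2s/(s + 1) > 1 and 2s/(s - 1). They are
the zeros of the coefficient, which factors accordingly. -/
theorem Cconst_coeff_nonneg {M p : ℝ} (hM : 0 < M)
    (hp : p ∈ Set.Icc (2 * ((M + 1) / M) - 2 * (√(M + 1) / M))
      (2 * ((M + 1) / M) + 2 * (√(M + 1) / M))) :
    1 < p ∧ 0 ≤ Cconst p - M * (1 - Cconst p) := by
  obtain ⟨h1, h2⟩ := hp
  set s := √(M + 1) with hs
  have hs2 : s ^ 2 = M + 1 := Real.sq_sqrt (by linarith)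
  have hs0 : 0 ≤ s := Real.sqrt_nonneg _
  have hs1 : 1 < s := by nlinarith
  have hMs : M = s ^ 2 - 1 := by linarith
  have h1' : 2 * (M + 1) - 2 * s ≤ p * M := by
    have : (2 * ((M + 1) / M) - 2 * (s / M)) * M ≤ p * M := mul_le_mul_of_nonneg_right h1 hM.le
    have e : (2 * ((M + 1) / M) - 2 * (s / M)) * M = 2 * (M + 1) - 2 * s := by field_simp
    linarith
  have h2' : p * M ≤ 2 * (M + 1) + 2 * s := by
    have : p * M ≤ (2 * ((M + 1) / M) + 2 * (s / M)) * M := mul_le_mul_of_nonneg_right h2 hM.le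
    have e : (2 * ((M + 1) / M) + 2 * (s / M)) * M = 2 * (M + 1) + 2 * s := by field_simp
    linarith
  have hs1' : 0 < s - 1 := by linarith
  have a1 : 2 * s ≤ p * (s + 1) := by
    have : (s - 1) * (2 * s) ≤ (s - 1) * (p * (s + 1)) := by rw [hMs] at h1'; nlinarith
    exact le_of_mul_le_mul_left this hs1'
  have a2 : p * (s - 1) ≤ 2 * s := by
    have : (s + 1) * (p * (s - 1)) ≤ (s + 1) * (2 * s) := by rw [hMs] at h2'; nlinarith
    exact le_of_mul_le_mul_left this (by linarith)
  have hp1 : 1 < p := by nlinarith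
  refine ⟨hp1, ?_⟩
  have e : Cconst p - M * (1 - Cconst p)
      = ((p * (s + 1) - 2 * s) * (2 * s - p * (s - 1))) / p ^ 2 := by
    rw [Cconst, hMs]; field_simp; ring
  rw [e]
  exact div_nonneg (mul_nonneg (by linarith) (by linarith)) (by positivity)

/-- The comparison with v = φ|φ|^{p/2-1}: C_p Q(v) absorbs the kinetic part, and the remaining (1 -
C_p) ∑ c|v|² is controlled by form boundedness applied to v, not to φ. -/
theorem Dconst_mul_sum_le {M C p lam : ℝ} (hc : G.IsFormBounded M C) (hp : 1 < p)
    (hM : 0 ≤ Cconst p - M * (1 - Cconst p))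
    (hlam : ∀ φ : X →₀ ℂ, lam * ‖G.toEll2 φ‖ ^ 2 ≤ G.energy φ)
    (φ : X →₀ ℂ) {K : Finset X} (hK : φ.support ⊆ K) :
    Dconst M C lam p * ∑ x ∈ K, G.m x * ‖φ x‖ ^ p
      ≤ (G.form φ (finsuppPow (p - 1) φ)).re := by
  set ψ := finsuppPow (p - 1) φ with hψ
  set v := finsuppPow (p / 2) φ with hv
  have hvK : v.support ⊆ K := (support_finsuppPow _ _).trans hK
  have hv2 : ∀ x, ‖v x‖ ^ 2 = ‖φ x‖ ^ p := by
    intro x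
    rw [hv, finsuppPow_apply, norm_signedPow (by linarith), ← Real.rpow_natCast,
      ← Real.rpow_mul (norm_nonneg _)]
    congr 1; push_cast; ring
  have hgrad : ∀ (q : ℝ) (x y : X), G.grad (finsuppPow q φ) x y
      = signedPow q (φ x) - signedPow q (G.o x y * φ y) := by
    intro q x y
    rw [grad, signedPow_mul_of_norm_eq_one q (G.o_norm x y), finsuppPow_apply, finsuppPow_apply]
  have hsq : ∀ z : ℂ, (z * conj z).re = ‖z‖ ^ 2 := by
    intro z; rw [Complex.mul_conj, Complex.normSq_eq_norm_sq, Complex.ofReal_re]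
  have hsumre : ∀ φ ψ : X →₀ ℂ, Summable fun z : X × X =>
      G.b z.1 z.2 * (G.grad φ z.1 z.2 * conj (G.grad ψ z.1 z.2)).re := by
    intro φ ψ
    refine (Complex.reCLM.summable (G.summable_form φ ψ)).congr fun z => ?_
    simp only [Complex.reCLM_apply, Complex.re_ofReal_mul]
  have hfin : ∀ g : X → ℝ, ∑' x, g x * ‖v x‖ ^ 2 = ∑ x ∈ K, g x * ‖v x‖ ^ 2 := by
    intro g
    refine tsum_eq_sum fun x hx => ?_
    simp [Finsupp.notMem_support_iff.mp fun h => hx (hvK h)]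
  have hpot : ∑' x, G.c x * (φ x * conj (ψ x)).re = ∑ x ∈ K, G.c x * ‖v x‖ ^ 2 := by
    rw [← hfin]
    refine tsum_congr fun x => ?_
    rw [hψ, finsuppPow_apply, mul_conj_signedPow hp, Complex.ofReal_re, hv2]
  have henergy : G.energy v = (1 / 2) * ∑' z : X × X, G.b z.1 z.2 *
      (G.grad v z.1 z.2 * conj (G.grad v z.1 z.2)).re + ∑ x ∈ K, G.c x * ‖v x‖ ^ 2 := by
    rw [energy, re_form]
    simp only [hsq]
    rw [hfin]
  have hkin : Cconst p * ∑' z : X × X, G.b z.1 z.2 *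
      (G.grad v z.1 z.2 * conj (G.grad v z.1 z.2)).re
      ≤ ∑' z : X × X, G.b z.1 z.2 * (G.grad φ z.1 z.2 * conj (G.grad ψ z.1 z.2)).re := by
    rw [← tsum_mul_left]
    refine ((hsumre v v).mul_left _).tsum_le_tsum (fun z => ?_) (hsumre φ ψ)
    rw [mul_left_comm, hsq, hgrad, hgrad]
    exact mul_le_mul_of_nonneg_left (Cconst_mul_norm_sq_le hp _ _) (G.b_nonneg _ _)
  have hneg : -∑ x ∈ K, G.c x * ‖v x‖ ^ 2 ≤ M * G.energy v + C * ‖G.toEll2 v‖ ^ 2 := by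
    refine le_trans ?_ (hc v)
    have e : ∀ x, G.m x * ‖(√(G.cNeg x / G.m x) : ℂ) * v x‖ ^ 2 = G.cNeg x * ‖v x‖ ^ 2 := by
      intro x
      have h0 : 0 ≤ G.cNeg x := neg_nonneg.mpr (min_le_right _ _)
      have hm := G.m_pos x
      rw [norm_mul, mul_pow, Complex.norm_real, Real.norm_of_nonneg (Real.sqrt_nonneg _),
        Real.sq_sqrt (by positivity)]
      field_simp
    simp only [e]
    rw [hfin, ← Finset.sum_neg_distrib]
    refine Finset.sum_le_sum fun x _ => ?_
    rw [← neg_mul]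
    exact mul_le_mul_of_nonneg_right (neg_le_neg (min_le_left _ _)) (sq_nonneg _)
  have hN : ‖G.toEll2 v‖ ^ 2 = ∑ x ∈ K, G.m x * ‖φ x‖ ^ p := by
    rw [G.norm_toEll2_sq v hvK]; simp only [hv2]
  rw [re_form, hpot, ← hN]
  have hC1 := Cconst_le_one hp
  -- The lower bound lam on Q(v) can be used only because its coefficient is nonnegative; this is
  -- where the range of p enters.
  have h1 := mul_le_mul_of_nonneg_left (hlam v) hM
  have h2 := mul_le_mul_of_nonneg_left hneg (sub_nonneg.mpr hC1)
  rw [Dconst]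
  generalize ‖G.toEll2 v‖ ^ 2 = N at *
  generalize (∑' z : X × X, G.b z.1 z.2 * (G.grad v z.1 z.2 * conj (G.grad v z.1 z.2)).re) = S at *
  generalize (∑ x ∈ K, G.c x * ‖v x‖ ^ 2) = P at *
  generalize (∑' z : X × X, G.b z.1 z.2 * (G.grad φ z.1 z.2 * conj (G.grad ψ z.1 z.2)).re) = S' at *
  have h3 : Cconst p * G.energy v = (1 / 2) * (Cconst p * S) + Cconst p * P := by
    rw [henergy]; ring
  linarith

/-- Testing a weak equation on a finite set with `φ |φ|^{p-2}` bounds its solution in `ℓ^p`. -/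
theorem rpow_mul_sum_le {p κ : ℝ} (hp : 1 < p) (hκ : 0 < κ) (φ : X →₀ ℂ) (f : X → ℂ)
    {K : Finset X}
    (h : κ * ∑ x ∈ K, G.m x * ‖φ x‖ ^ p
      ≤ (∑ x ∈ K, (G.m x : ℂ) * (f x * conj (finsuppPow (p - 1) φ x))).re) {B : ℝ} (hB : 0 ≤ B)
    (hf : ∑ x ∈ K, G.m x * ‖f x‖ ^ p ≤ B ^ p) :
    ∑ x ∈ K, G.m x * ‖φ x‖ ^ p ≤ (B / κ) ^ p := by
  have hp0 : 0 < p := by linarith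
  have hp1 : 0 < p - 1 := by linarith
  set S := ∑ x ∈ K, G.m x * ‖φ x‖ ^ p with hS
  have hS0 : 0 ≤ S := Finset.sum_nonneg fun x _ =>
    mul_nonneg (G.m_pos x).le (Real.rpow_nonneg (norm_nonneg _) _)
  have hpq : p.HolderConjugate (p / (p - 1)) := Real.HolderConjugate.conjExponent hp
  -- The weight is split as m = m^{1/p} m^{(p-1)/p}, which reduces to the unweighted Hölder
  -- inequality.
  have hterm : (∑ x ∈ K, (G.m x : ℂ) * (f x * conj (finsuppPow (p - 1) φ x))).re
      ≤ ∑ x ∈ K, (G.m x ^ (1 / p) * ‖f x‖) * (G.m x ^ ((p - 1) / p) * ‖φ x‖ ^ (p - 1)) := by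
    refine (Complex.re_le_norm _).trans ((norm_sum_le _ _).trans (le_of_eq ?_))
    refine Finset.sum_congr rfl fun x _ => ?_
    have hm := G.m_pos x
    rw [norm_mul, norm_mul, RCLike.norm_conj, finsuppPow_apply, norm_signedPow hp1,
      Complex.norm_real, Real.norm_of_nonneg hm.le, mul_mul_mul_comm, ← Real.rpow_add hm]
    congr 1
    rw [← add_div, add_sub_cancel, div_self hp0.ne', Real.rpow_one]
  have holder := Real.inner_le_Lp_mul_Lq_of_nonneg K hpq
    (f := fun x => G.m x ^ (1 / p) * ‖f x‖)
    (g := fun x => G.m x ^ ((p - 1) / p) * ‖φ x‖ ^ (p - 1))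
    (fun x _ => mul_nonneg (Real.rpow_nonneg (G.m_pos x).le _) (norm_nonneg _))
    (fun x _ => mul_nonneg (Real.rpow_nonneg (G.m_pos x).le _)
      (Real.rpow_nonneg (norm_nonneg _) _))
  have e1 : ∀ x, (G.m x ^ (1 / p) * ‖f x‖) ^ p = G.m x * ‖f x‖ ^ p := by
    intro x
    have hm := (G.m_pos x).le
    rw [Real.mul_rpow (by positivity) (norm_nonneg _), ← Real.rpow_mul hm, one_div,
      inv_mul_cancel₀ hp0.ne', Real.rpow_one]
  have e2 : ∀ x, (G.m x ^ ((p - 1) / p) * ‖φ x‖ ^ (p - 1)) ^ (p / (p - 1))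
      = G.m x * ‖φ x‖ ^ p := by
    intro x
    have hm := (G.m_pos x).le
    rw [Real.mul_rpow (by positivity) (by positivity), ← Real.rpow_mul hm,
      ← Real.rpow_mul (norm_nonneg _)]
    congr 1
    · rw [show (p - 1) / p * (p / (p - 1)) = 1 by field_simp, Real.rpow_one]
    · congr 1; field_simp
  simp only [e1, e2, ← hS] at holder
  have hBS : (∑ x ∈ K, G.m x * ‖f x‖ ^ p) ^ (1 / p) ≤ B := by
    refine (Real.rpow_le_rpow (Finset.sum_nonneg fun x _ =>
      mul_nonneg (G.m_pos x).le (Real.rpow_nonneg (norm_nonneg _) _)) hf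
      (by positivity)).trans (le_of_eq ?_)
    rw [← Real.rpow_mul hB, mul_one_div, div_self hp0.ne', Real.rpow_one]
  have main : κ * S ≤ B * S ^ (1 / (p / (p - 1))) :=
    h.trans (hterm.trans (holder.trans
      (mul_le_mul_of_nonneg_right hBS (Real.rpow_nonneg hS0 _))))
  -- A power of S is to be cancelled, hence the separate case S = 0.
  rcases hS0.eq_or_lt with h0 | hSpos
  · rw [← h0]; exact Real.rpow_nonneg (div_nonneg hB hκ.le) _
  · have hsplit : S = S ^ (1 / p) * S ^ (1 / (p / (p - 1))) := by
      rw [← Real.rpow_add hSpos, show 1 / p + 1 / (p / (p - 1)) = 1 by field_simp; ring,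
        Real.rpow_one]
    have hle : κ * S ^ (1 / p) ≤ B := by
      refine le_of_mul_le_mul_right (a := S ^ (1 / (p / (p - 1)))) ?_ (Real.rpow_pos_of_pos hSpos _)
      rw [mul_assoc, ← hsplit]; exact main
    have : S ^ (1 / p) ≤ B / κ := by rw [le_div_iff₀ hκ]; linarith
    calc S = (S ^ (1 / p)) ^ p := by
          rw [← Real.rpow_mul hS0, one_div, inv_mul_cancel₀ hp0.ne', Real.rpow_one]
      _ ≤ _ := Real.rpow_le_rpow (by positivity) this hp0.le

end MagneticSchrodingerGraph

/-- Applied to (H + 1)⁻¹, this produces the spectral point ‖R‖⁻¹ - 1 of H. -/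
theorem ContinuousLinearMap.IsPositive.norm_mem_spectrum {F : Type*} [NormedAddCommGroup F]
    [InnerProductSpace ℂ F] [CompleteSpace F] [Nontrivial F] {R : F →L[ℂ] F} (hR : R.IsPositive) :
    (‖R‖ : ℂ) ∈ spectrum ℂ R := by
  have hpos : 0 ≤ R := (ContinuousLinearMap.nonneg_iff_isPositive _).mpr hR
  exact spectrum.algebraMap_mem ℂ (CStarAlgebra.norm_mem_spectrum_of_nonneg hpos)

namespace MagneticSchrodingerGraph

variable {X : Type*} (G : MagneticSchrodingerGraph X)

/-! ### The form domain -/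

/-- The finitely supported functions with the inner product `Q(φ, ψ) + a ⟨φ, ψ⟩`. -/
def FormSpace (_ : G.IsPositive) {a : ℝ} (_ : 0 < a) : Type _ := X →₀ ℂ

variable (hG : G.IsPositive) {a : ℝ} (ha : 0 < a)

instance : AddCommGroup (G.FormSpace hG ha) := inferInstanceAs (AddCommGroup (X →₀ ℂ))

instance : Module ℂ (G.FormSpace hG ha) := inferInstanceAs (Module ℂ (X →₀ ℂ))

theorem re_mul_inner_self (a : ℝ) (f : G.ell 2) :
    RCLike.re ((a : ℂ) * inner ℂ f f) = a * ‖f‖ ^ 2 := by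
  rw [← inner_self_eq_norm_sq (𝕜 := ℂ) f]
  exact Complex.re_ofReal_mul a _

/-- The form inner product `Q(φ, ψ) + a ⟨φ, ψ⟩`. -/
@[reducible]
def formCore : PreInnerProductSpace.Core ℂ (X →₀ ℂ) where
  -- The arguments are swapped because `form` is linear in the first variable and `inner` in the
  -- second.
  inner φ ψ := G.form ψ φ + a * inner ℂ (G.toEll2 φ) (G.toEll2 ψ)
  conj_inner_symm φ ψ := by
    rw [map_add, map_mul, Complex.conj_ofReal, G.conj_form, inner_conj_symm]
  re_inner_nonneg φ := by
    rw [map_add, re_mul_inner_self]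
    exact add_nonneg (hG φ) (by positivity)
  add_left φ ψ χ := by
    rw [← G.conj_form, G.form_add_left, map_add, G.conj_form, G.conj_form, map_add, inner_add_left]
    ring
  smul_left φ ψ r := by
    rw [← G.conj_form, G.form_smul_left, map_mul, G.conj_form, map_smul, inner_smul_left]
    ring

/-- The form inner product on the form space. -/
@[reducible]
def formSpaceCore : PreInnerProductSpace.Core ℂ (G.FormSpace hG ha) :=
  { inner := (G.formCore hG ha).inner
    conj_inner_symm := (G.formCore hG ha).conj_inner_symm
    re_inner_nonneg := (G.formCore hG ha).re_inner_nonneg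
    add_left := (G.formCore hG ha).add_left
    smul_left := (G.formCore hG ha).smul_left }

instance : SeminormedAddCommGroup (G.FormSpace hG ha) :=
  @InnerProductSpace.Core.toSeminormedAddCommGroup ℂ _ _ _ _ (G.formSpaceCore hG ha)

instance : InnerProductSpace ℂ (G.FormSpace hG ha) :=
  InnerProductSpace.ofCore (G.formSpaceCore hG ha)

/-- The form domain, as an abstract completion. -/
abbrev FormDomain := UniformSpace.Completion (G.FormSpace hG ha)

/-- The inclusion of the finitely supported functions into the form domain. -/
def toFormDomain : (X →₀ ℂ) →ₗ[ℂ] G.FormDomain hG ha :=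
  (UniformSpace.Completion.toComplL (𝕜 := ℂ) (E := G.FormSpace hG ha)).toLinearMap

theorem denseRange_toFormDomain : DenseRange (G.toFormDomain hG ha) :=
  UniformSpace.Completion.denseRange_coe (α := G.FormSpace hG ha)

theorem inner_toFormDomain (φ ψ : X →₀ ℂ) :
    inner ℂ (G.toFormDomain hG ha φ) (G.toFormDomain hG ha ψ)
      = G.form ψ φ + a * inner ℂ (G.toEll2 φ) (G.toEll2 ψ) :=
  UniformSpace.Completion.inner_coe (𝕜 := ℂ) (E := G.FormSpace hG ha) φ ψ

theorem norm_toFormDomain_sq (φ : X →₀ ℂ) :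
    ‖G.toFormDomain hG ha φ‖ ^ 2 = G.energy φ + a * ‖G.toEll2 φ‖ ^ 2 := by
  rw [← inner_self_eq_norm_sq (𝕜 := ℂ), inner_toFormDomain, map_add, re_mul_inner_self]
  rfl

theorem norm_toEll2_le (φ : X →₀ ℂ) :
    ‖G.toEll2 φ‖ ≤ (√a)⁻¹ * ‖G.toFormDomain hG ha φ‖ := by
  have h := G.norm_toFormDomain_sq hG ha φ
  have hs : 0 < √a := Real.sqrt_pos.mpr ha
  rw [inv_mul_eq_div, le_div_iff₀ hs]
  refine le_of_sq_le_sq ?_ (norm_nonneg _)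
  rw [mul_pow, Real.sq_sqrt ha.le, h, mul_comm]
  linarith [hG φ]

/-- The natural map of the form domain into `ℓ²`. -/
def formIncl : G.FormDomain hG ha →L[ℂ] G.ell 2 :=
  G.toEll2.extendOfNorm (G.toFormDomain hG ha)

@[simp]
theorem formIncl_toFormDomain (φ : X →₀ ℂ) :
    G.formIncl hG ha (G.toFormDomain hG ha φ) = G.toEll2 φ :=
  LinearMap.extendOfNorm_eq (G.denseRange_toFormDomain hG ha) ⟨_, G.norm_toEll2_le hG ha⟩ φ

/-- The resolvent `(H + a)⁻¹`. -/
def resolvent : G.ell 2 →L[ℂ] G.ell 2 :=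
  (G.formIncl hG ha) ∘L (G.formIncl hG ha).adjoint

/-- J*f is the Riesz representative of ⟨f, ·⟩ in the form domain, that is, the weak solution of (H +
a)v = f. -/
theorem inner_toFormDomain_adjoint (φ : X →₀ ℂ) (f : G.ell 2) :
    inner ℂ (G.toFormDomain hG ha φ) ((G.formIncl hG ha).adjoint f) = inner ℂ (G.toEll2 φ) f := by
  rw [ContinuousLinearMap.adjoint_inner_right, formIncl_toFormDomain]

theorem eq_adjoint_of_inner {v : G.FormDomain hG ha} {f : G.ell 2}
    (h : ∀ φ : X →₀ ℂ, inner ℂ (G.toFormDomain hG ha φ) v = inner ℂ (G.toEll2 φ) f) :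
    v = (G.formIncl hG ha).adjoint f := by
  refine (G.denseRange_toFormDomain hG ha).eq_of_inner_right ℂ fun φ => ?_
  rw [h, inner_toFormDomain_adjoint]

theorem isPositive_resolvent : (G.resolvent hG ha).IsPositive := by
  have := ContinuousLinearMap.isPositive_adjoint_comp_self (G.formIncl hG ha).adjoint
  rwa [ContinuousLinearMap.adjoint_adjoint] at this

/-- If J J*f = 0 then ‖J*f‖² = ⟨f, J J*f⟩ = 0, so f is orthogonal to the range of J, which contains
all finitely supported functions. -/
theorem resolvent_injective : Function.Injective (G.resolvent hG ha) := by
  rw [injective_iff_map_eq_zero]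
  intro f hf
  have h1 : (G.formIncl hG ha).adjoint f = 0 := by
    refine inner_self_eq_zero (𝕜 := ℂ).mp ?_
    have : G.formIncl hG ha ((G.formIncl hG ha).adjoint f) = 0 := hf
    rw [ContinuousLinearMap.adjoint_inner_left, this, inner_zero_right]
  refine G.denseRange_toEll2.eq_zero_of_inner_right ℂ fun φ => ?_
  rw [← G.inner_toFormDomain_adjoint hG ha, h1]
  exact inner_zero_right _

/-- Being Cauchy both for Q and in ℓ² is being Cauchy in the form norm. -/
theorem exists_tendsto_of_isApprox {f : G.ell 2} {φ : ℕ → X →₀ ℂ} (h : G.IsApprox f φ) :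
    ∃ v, Tendsto (fun n => G.toFormDomain hG ha (φ n)) atTop (𝓝 v) ∧ G.formIncl hG ha v = f := by
  have hc : CauchySeq fun n => G.toFormDomain hG ha (φ n) := by
    rw [cauchySeq_iff_tendsto_dist_atTop_0]
    have h1 := cauchySeq_iff_tendsto_dist_atTop_0.mp h.1.cauchySeq
    have h2 := (h.2.add ((h1.pow 2).const_mul a)).sqrt
    simp only [ne_eq, OfNat.ofNat_ne_zero, not_false_eq_true, zero_pow, mul_zero, add_zero,
      Real.sqrt_zero] at h2
    refine h2.congr fun k => ?_
    rw [dist_eq_norm, dist_eq_norm, ← map_sub, ← map_sub, ← G.norm_toFormDomain_sq hG ha,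
      Real.sqrt_sq (norm_nonneg _)]
  obtain ⟨v, hv⟩ := cauchySeq_tendsto_of_complete hc
  refine ⟨v, hv, tendsto_nhds_unique ?_ h.1⟩
  simpa only [Function.comp_def, formIncl_toFormDomain]
    using ((G.formIncl hG ha).continuous.tendsto v).comp hv

theorem isApprox_of_tendsto {v : G.FormDomain hG ha} {φ : ℕ → X →₀ ℂ}
    (h : Tendsto (fun n => G.toFormDomain hG ha (φ n)) atTop (𝓝 v)) :
    G.IsApprox (G.formIncl hG ha v) φ := by
  refine ⟨?_, ?_⟩
  · simpa only [Function.comp_def, formIncl_toFormDomain]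
      using ((G.formIncl hG ha).continuous.tendsto v).comp h
  · have h1 := (cauchySeq_iff_tendsto_dist_atTop_0.mp h.cauchySeq).pow 2
    rw [zero_pow two_ne_zero] at h1
    refine squeeze_zero (fun _ => hG _) (fun k => ?_) h1
    rw [dist_eq_norm, ← map_sub, norm_toFormDomain_sq]
    have : 0 ≤ a * ‖G.toEll2 (φ k.1 - φ k.2)‖ ^ 2 := by positivity
    linarith

theorem exists_seq_tendsto (v : G.FormDomain hG ha) : ∃ φ : ℕ → X →₀ ℂ,
    Tendsto (fun n => G.toFormDomain hG ha (φ n)) atTop (𝓝 v) := by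
  obtain ⟨u, hu, hv⟩ := mem_closure_iff_seq_limit.mp (G.denseRange_toFormDomain hG ha v)
  choose φ hφ using hu
  exact ⟨φ, by simpa only [hφ] using hv⟩

theorem tendsto_form {v w : G.FormDomain hG ha} {φ ψ : ℕ → X →₀ ℂ}
    (hφ : Tendsto (fun n => G.toFormDomain hG ha (φ n)) atTop (𝓝 v))
    (hψ : Tendsto (fun n => G.toFormDomain hG ha (ψ n)) atTop (𝓝 w)) :
    Tendsto (fun n => G.form (φ n) (ψ n)) atTop
      (𝓝 (inner ℂ w v - a * inner ℂ (G.formIncl hG ha w) (G.formIncl hG ha v))) := by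
  have h1 := (G.isApprox_of_tendsto hG ha hφ).1
  have h2 := (G.isApprox_of_tendsto hG ha hψ).1
  refine ((hψ.inner (𝕜 := ℂ) hφ).sub ((h2.inner (𝕜 := ℂ) h1).const_mul (a : ℂ))).congr fun n => ?_
  rw [inner_toFormDomain]; ring

/-- By density, the defining identity of H need only be tested on C_c(X), where it says that the
form limit of the approximants is J*(h + a f). -/
theorem mem_opGraph_iff {u : G.ell 2 × G.ell 2} :
    u ∈ G.opGraph hG ↔ G.resolvent hG ha (u.2 + (a : ℂ) • u.1) = u.1 := by
  constructor
  · rintro ⟨φ, hφ, h⟩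
    obtain ⟨v, hv, hvu⟩ := G.exists_tendsto_of_isApprox hG ha hφ
    have : v = (G.formIncl hG ha).adjoint (u.2 + (a : ℂ) • u.1) := by
      refine G.eq_adjoint_of_inner hG ha fun ψ => ?_
      have hψ : Tendsto (fun _ : ℕ => G.toFormDomain hG ha ψ) atTop
        (𝓝 (G.toFormDomain hG ha ψ)) := tendsto_const_nhds
      have hψ' := G.isApprox_of_tendsto hG ha hψ
      have := tendsto_nhds_unique (h _ _ hψ') (G.tendsto_form hG ha hv hψ)
      rw [hvu, formIncl_toFormDomain] at this
      rw [inner_add_right, inner_smul_right, this]; ring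
    rw [resolvent, ContinuousLinearMap.comp_apply, ← this, hvu]
  · intro h
    set v := (G.formIncl hG ha).adjoint (u.2 + (a : ℂ) • u.1) with hv
    have hvu : G.formIncl hG ha v = u.1 := h
    obtain ⟨φ, hφ⟩ := G.exists_seq_tendsto hG ha v
    refine ⟨φ, hvu ▸ G.isApprox_of_tendsto hG ha hφ, fun g ψ hψ => ?_⟩
    obtain ⟨w, hw, hwg⟩ := G.exists_tendsto_of_isApprox hG ha hψ
    have := G.tendsto_form hG ha hφ hw
    rw [hvu, hwg, hv, ContinuousLinearMap.adjoint_inner_right, hwg, inner_add_right,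
      inner_smul_right, add_sub_cancel_right] at this
    exact this

/-- Single-valuedness of the graph, without which `toLinearPMap` would not have it as its graph. -/
theorem opGraph_snd_eq_zero (u : G.ell 2 × G.ell 2) (hu : u ∈ G.opGraph hG) (h0 : u.1 = 0) :
    u.2 = 0 := by
  rw [G.mem_opGraph_iff hG one_pos, h0, smul_zero, add_zero] at hu
  exact (injective_iff_map_eq_zero _).mp (G.resolvent_injective hG one_pos) _ hu

theorem mem_graph_H (x : (G.H hG).domain) : ((x : G.ell 2), G.H hG x) ∈ G.opGraph hG :=
  Submodule.mem_graph_toLinearPMap (G.opGraph_snd_eq_zero hG) x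

theorem H_eq_of_mem {u : G.ell 2 × G.ell 2} (hu : u ∈ G.opGraph hG) :
    ∃ h : u.1 ∈ (G.H hG).domain, G.H hG ⟨u.1, h⟩ = u.2 := by
  have h : u.1 ∈ (G.H hG).domain := ⟨u, hu, rfl⟩
  refine ⟨h, ?_⟩
  have h1 := (G.opGraph hG).sub_mem (G.mem_graph_H hG ⟨u.1, h⟩) hu
  have := G.opGraph_snd_eq_zero hG _ h1 (sub_self _)
  exact sub_eq_zero.mp this

theorem isResolventAt_resolvent : IsResolventAt (G.H hG) (-a : ℂ) (G.resolvent hG ha) := by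
  refine ⟨fun y => ?_, fun x => ?_⟩
  · have hu : (G.resolvent hG ha y, y - (a : ℂ) • G.resolvent hG ha y) ∈ G.opGraph hG := by
      rw [G.mem_opGraph_iff hG ha, sub_add_cancel]
    obtain ⟨h, h'⟩ := G.H_eq_of_mem hG hu
    refine ⟨h, ?_⟩
    rw [h', neg_smul, sub_neg_eq_add, sub_add_cancel]
  · have := (G.mem_opGraph_iff hG ha).mp (G.mem_graph_H hG x)
    rwa [neg_smul, sub_neg_eq_add]

theorem pmapResolvent_H : pmapResolvent (G.H hG) (-1) = G.resolvent hG one_pos := by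
  have h1 := G.isResolventAt_resolvent hG one_pos
  rw [Complex.ofReal_one] at h1
  have hex : ∃ R, IsResolventAt (G.H hG) (-1) R := ⟨_, h1⟩
  rw [pmapResolvent, dif_pos hex]
  ext1 y
  obtain ⟨hy, hy'⟩ := hex.choose_spec.1 y
  have := h1.2 ⟨_, hy⟩
  rw [hy'] at this
  exact this.symm

/-! ### The bottom of the spectrum -/

theorem norm_formIncl_sq : ‖G.formIncl hG ha‖ ^ 2 = ‖G.resolvent hG ha‖ := by
  have := ContinuousLinearMap.norm_adjoint_comp_self (G.formIncl hG ha).adjoint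
  rw [ContinuousLinearMap.adjoint_adjoint, LinearIsometryEquiv.norm_map] at this
  rw [resolvent, this, sq]

/-- Spectral mapping by contraposition: an inverse of H - z, with 1 + z = μ⁻¹, makes μ - R
bijective, and bijectivity suffices by the open mapping theorem. -/
theorem mem_pmapSpectrum_of_mem_spectrum {μ : ℝ} (hμ : 0 < μ)
    (h : (μ : ℂ) ∈ spectrum ℂ (G.resolvent hG one_pos)) :
    ((μ⁻¹ - 1 : ℝ) : ℂ) ∈ pmapSpectrum (G.H hG) := by
  rintro ⟨S, hS⟩
  refine h ?_
  rw [spectrum.mem_resolventSet_iff]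
  have hμ' : (μ : ℂ) ≠ 0 := by exact_mod_cast hμ.ne'
  set R := G.resolvent hG one_pos with hR
  have hRes := G.isResolventAt_resolvent hG one_pos
  set z : ℂ := ((μ⁻¹ - 1 : ℝ) : ℂ) with hz
  have hz1 : 1 + z = (μ : ℂ)⁻¹ := by rw [hz]; push_cast; ring
  -- `(H - z) R = 1 - (1 + z) R`
  have key : ∀ y, ∃ hy : R y ∈ (G.H hG).domain,
      G.H hG ⟨R y, hy⟩ - z • R y = (μ : ℂ)⁻¹ • ((μ : ℂ) • y - R y) := by
    intro y
    obtain ⟨hy, h'⟩ := hRes.1 y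
    refine ⟨hy, ?_⟩
    rw [Complex.ofReal_one, neg_smul, one_smul, sub_neg_eq_add] at h'
    rw [smul_sub, smul_smul, inv_mul_cancel₀ hμ', one_smul, ← hz1, eq_sub_of_add_eq h']
    module
  rw [ContinuousLinearMap.isUnit_iff_bijective]
  have happ : ∀ y, (algebraMap ℂ (G.ell 2 →L[ℂ] G.ell 2) μ - R) y = (μ : ℂ) • y - R y := by
    intro y
    rw [Algebra.algebraMap_eq_smul_one]
    rfl
  constructor
  · rw [injective_iff_map_eq_zero]
    intro y hy
    rw [happ] at hy
    obtain ⟨hd, h1⟩ := key y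
    rw [hy, smul_zero] at h1
    have h2 := hS.2 ⟨R y, hd⟩
    rw [h1, map_zero] at h2
    exact (injective_iff_map_eq_zero _).mp (G.resolvent_injective hG one_pos) _ h2.symm
  · intro y
    obtain ⟨hd, h1⟩ := hS.1 ((μ : ℂ)⁻¹ • y)
    set x := S ((μ : ℂ)⁻¹ • y)
    have h2 := hRes.2 ⟨x, hd⟩
    -- The preimage is w = (H + 1)x, chosen so that R w = x.
    set w := G.H hG ⟨x, hd⟩ - (-(1 : ℝ) : ℂ) • x
    obtain ⟨hd', h3⟩ := key w
    refine ⟨w, ?_⟩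
    rw [happ]
    have h4 : (⟨R w, hd'⟩ : (G.H hG).domain) = ⟨x, hd⟩ := Subtype.ext h2
    rw [h4, show R w = x from h2, h1] at h3
    rw [show R w = x from h2]
    exact (smul_right_injective _ (inv_ne_zero hμ') h3).symm

/-- Negative numbers lie in the resolvent set. Boundedness is needed for `sInf` to be a lower bound.
-/
theorem bddBelow_pmapSpectrum : BddBelow {x : ℝ | (x : ℂ) ∈ pmapSpectrum (G.H hG)} := by
  refine ⟨0, fun x hx => ?_⟩
  by_contra h
  have h0 : 0 < -x := by linarith [not_le.mp h]
  refine hx ⟨G.resolvent hG h0, ?_⟩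
  have := G.isResolventAt_resolvent hG h0
  simpa using this

/-- The bottom of the spectrum is a lower bound of the form. -/
theorem lam2_mul_norm_sq_le (φ : X →₀ ℂ) : G.lam2 hG * ‖G.toEll2 φ‖ ^ 2 ≤ G.energy φ := by
  rcases subsingleton_or_nontrivial (G.ell 2) with hs | hn
  · rw [Subsingleton.elim (G.toEll2 φ) 0, norm_zero, zero_pow two_ne_zero, mul_zero]
    exact hG φ
  set R := G.resolvent hG one_pos with hR
  have hN : 0 < ‖R‖ := by
    rw [norm_pos_iff]
    intro h0
    obtain ⟨x, hx⟩ := exists_ne (0 : G.ell 2)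
    refine hx ((injective_iff_map_eq_zero _).mp (G.resolvent_injective hG one_pos) x ?_)
    rw [← hR, h0, zero_apply]
  -- Since ‖J‖² = ‖R‖, one has ‖φ‖² ≤ ‖R‖(Q(φ) + ‖φ‖²), so Q ≥ ‖R‖⁻¹ - 1; this number is in the
  -- spectrum and hence at least λ₂.
  have hmem := (G.isPositive_resolvent hG one_pos).norm_mem_spectrum
  have hmem2 := G.mem_pmapSpectrum_of_mem_spectrum hG hN hmem
  have hlam : G.lam2 hG ≤ ‖R‖⁻¹ - 1 := csInf_le (G.bddBelow_pmapSpectrum hG) hmem2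
  have hle : ‖G.toEll2 φ‖ ^ 2 ≤ ‖R‖ * (G.energy φ + ‖G.toEll2 φ‖ ^ 2) := by
    have h1 := (G.formIncl hG one_pos).le_opNorm (G.toFormDomain hG one_pos φ)
    rw [formIncl_toFormDomain] at h1
    have h2 := pow_le_pow_left₀ (norm_nonneg _) h1 2
    rwa [mul_pow, norm_formIncl_sq, norm_toFormDomain_sq, one_mul] at h2
  have h3 : ‖R‖⁻¹ * ‖G.toEll2 φ‖ ^ 2 ≤ G.energy φ + ‖G.toEll2 φ‖ ^ 2 := by
    rw [inv_mul_le_iff₀ hN]; exact hle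
  nlinarith [mul_le_mul_of_nonneg_right hlam (sq_nonneg ‖G.toEll2 φ‖)]

/-! ### Approximation by finite subsets -/

/-- The u K represent the orthogonal projections of J*f, in the form domain, onto the
finite-dimensional spaces of functions supported in K. These spaces increase to a dense subspace, so
the projections converge. -/
theorem exists_galerkin (f : G.ell 2) : ∃ u : Finset X → X →₀ ℂ,
    (∀ K, (u K).support ⊆ K) ∧
    (∀ K, ∀ ψ : X →₀ ℂ, ψ.support ⊆ K →
      G.form (u K) ψ + a * inner ℂ (G.toEll2 ψ) (G.toEll2 (u K)) = inner ℂ (G.toEll2 ψ) f) ∧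
    Tendsto (fun K => G.toEll2 (u K)) atTop (𝓝 (G.resolvent hG ha f)) := by
  classical
  let U : Finset X → Submodule ℂ (G.FormDomain hG ha) := fun K =>
    (Finsupp.supported ℂ ℂ (K : Set X)).map (G.toFormDomain hG ha)
  have hfd : ∀ K, FiniteDimensional ℂ (U K) := by
    intro K
    have : FiniteDimensional ℂ (Finsupp.supported ℂ ℂ (K : Set X)) :=
      Module.Finite.equiv (Finsupp.supportedEquivFinsupp (M := ℂ) (R := ℂ) (K : Set X)).symm
    exact Module.Finite.map _ _
  have hmono : Monotone U := fun K L hKL =>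
    Submodule.map_mono (Finsupp.supported_mono (Finset.coe_subset.mpr hKL))
  have hdense : ⊤ ≤ (⨆ K, U K).topologicalClosure := by
    intro v _
    refine closure_mono ?_ (G.denseRange_toFormDomain hG ha v)
    rintro _ ⟨φ, rfl⟩
    refine Submodule.mem_iSup_of_mem φ.support ⟨φ, ?_, rfl⟩
    exact (Finsupp.mem_supported ℂ φ).mpr subset_rfl
  set v := (G.formIncl hG ha).adjoint f with hv
  have hlim := Submodule.starProjection_tendsto_self U hmono v hdense
  have hex : ∀ K, ∃ φ : X →₀ ℂ, φ.support ⊆ K ∧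
      G.toFormDomain hG ha φ = (U K).starProjection v := by
    intro K
    obtain ⟨φ, h1, h2⟩ := Submodule.starProjection_apply_mem (U K) v
    exact ⟨φ, Finset.coe_subset.mp ((Finsupp.mem_supported ℂ φ).mp h1), h2⟩
  choose u hu1 hu2 using hex
  refine ⟨u, hu1, fun K ψ hψ => ?_, ?_⟩
  · rw [← G.inner_toFormDomain hG ha, hu2, ← G.inner_toFormDomain_adjoint hG ha, ← hv,
      ← sub_eq_zero, ← inner_sub_right, ← neg_sub v, inner_neg_right, neg_eq_zero]
    have hmem : G.toFormDomain hG ha ψ ∈ U K :=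
      ⟨ψ, (Finsupp.mem_supported ℂ ψ).mpr (Finset.coe_subset.mpr hψ), rfl⟩
    exact Submodule.inner_right_of_mem_orthogonal hmem (Submodule.sub_starProjection_mem_orthogonal v)
  · have := ((G.formIncl hG ha).continuous.tendsto v).comp hlim
    simp only [Function.comp_def, ← hu2, formIncl_toFormDomain] at this
    exact this

/-- The `ℓ^p`-bound of the resolvent. -/
theorem eLpNorm_resolvent_le {M C p : ℝ} (hc : G.IsFormBounded M C) (hp : 1 < p)
    (hM : 0 ≤ Cconst p - M * (1 - Cconst p)) (hκ : 0 < a + Dconst M C (G.lam2 hG) p)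
    (f : G.ell 2) (hf : MemLp f (ENNReal.ofReal p) G.measure) :
    eLpNorm (G.resolvent hG ha f) (ENNReal.ofReal p) G.measure ≤
      ENNReal.ofReal ((a + Dconst M C (G.lam2 hG) p)⁻¹) *
        eLpNorm f (ENNReal.ofReal p) G.measure := by
  obtain ⟨u, hu1, hu2, hu3⟩ := G.exists_galerkin hG ha f
  set D := Dconst M C (G.lam2 hG) p with hD
  set B := (eLpNorm f (ENNReal.ofReal p) G.measure).toReal with hB
  have hB0 : 0 ≤ B := ENNReal.toReal_nonneg
  have hBf : eLpNorm f (ENNReal.ofReal p) G.measure = ENNReal.ofReal B :=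
    (ENNReal.ofReal_toReal hf.2.ne).symm
  rw [hBf, ← ENNReal.ofReal_mul (inv_nonneg.mpr hκ.le), inv_mul_eq_div]
  refine G.eLpNorm_le_of_tendsto hp.le (l := atTop) (g := fun K => (u K : X → ℂ)) (fun x => ?_)
    tendsto_const_nhds (Eventually.of_forall fun K => div_nonneg hB0 hκ.le)
    (Eventually.of_forall fun K => ?_)
  · simpa only [Function.comp_def, coeFn_toEll2] using ((G.continuous_eval x).tendsto _).comp hu3
  · rw [G.eLpNorm_le_iff hp.le _ (div_nonneg hB0 hκ.le)]
    -- The weak equation is tested with u|u|^{p-2}, which is again supported in K.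
    have hK : ∑ x ∈ K, G.m x * ‖u K x‖ ^ p ≤ (B / (a + D)) ^ p := by
      refine G.rpow_mul_sum_le hp hκ (u K) f ?_ hB0 (G.sum_le_eLpNorm hp.le hf K)
      have hψ : (finsuppPow (p - 1) (u K)).support ⊆ K := (support_finsuppPow _ _).trans (hu1 K)
      rw [← G.inner_toEll2 _ f hψ, ← hu2 K _ hψ, Complex.add_re, Complex.re_ofReal_mul,
        G.inner_toEll2 _ _ hψ, coeFn_toEll2, Complex.re_sum]
      have e : ∀ x, ((G.m x : ℂ) * (u K x * conj (finsuppPow (p - 1) (u K) x))).re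
          = G.m x * ‖u K x‖ ^ p := by
        intro x
        rw [finsuppPow_apply, mul_conj_signedPow hp, ← Complex.ofReal_mul, Complex.ofReal_re]
      simp only [e]
      have := G.Dconst_mul_sum_le hc hp hM (G.lam2_mul_norm_sq_le hG) (u K) (hu1 K)
      rw [← hD] at this
      linarith
    intro L
    classical
    refine le_trans ?_ hK
    have hz : ∀ x, x ∉ K → G.m x * ‖u K x‖ ^ p = 0 := by
      intro x hx
      rw [Finsupp.notMem_support_iff.mp fun h => hx (hu1 K h), norm_zero,
        Real.zero_rpow (by linarith), mul_zero]
    calc ∑ x ∈ L, G.m x * ‖u K x‖ ^ p ≤ ∑ x ∈ L ∪ K, G.m x * ‖u K x‖ ^ p :=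
          Finset.sum_le_sum_of_subset_of_nonneg Finset.subset_union_left fun x _ _ =>
            mul_nonneg (G.m_pos x).le (Real.rpow_nonneg (norm_nonneg _) _)
      _ = _ := (Finset.sum_subset Finset.subset_union_right fun x _ hx => hz x hx).symm

end MagneticSchrodingerGraph

/-! ### The profile of the exponential -/

theorem expProfile_zero_left (r : ℝ) : expProfile 0 r = 1 := by simp [expProfile]

theorem expProfile_of_ne {r : ℝ} (hr : r ≠ 0) (t : ℝ) :
    expProfile t r = Real.exp (-t * (r⁻¹ - 1)) := by simp [expProfile, hr]

theorem expProfile_nonneg (t r : ℝ) : 0 ≤ expProfile t r := by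
  unfold expProfile; split_ifs
  · exact le_rfl
  · exact (Real.exp_pos _).le

theorem expProfile_le_one {t r : ℝ} (ht : 0 ≤ t) (hr : 0 ≤ r) (hr1 : r ≤ 1) :
    expProfile t r ≤ 1 := by
  unfold expProfile; split_ifs with h
  · exact zero_le_one
  · rw [Real.exp_le_one_iff]
    rcases hr.eq_or_lt with rfl | hr0
    · have : t = 0 := by simpa using h
      simp [this]
    · have : 1 ≤ r⁻¹ := (one_le_inv₀ hr0).mpr hr1
      nlinarith

theorem expProfile_add {s t : ℝ} (hs : 0 ≤ s) (ht : 0 ≤ t) (r : ℝ) :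
    expProfile (s + t) r = expProfile s r * expProfile t r := by
  rcases eq_or_ne r 0 with rfl | hr
  · rcases hs.eq_or_lt with rfl | hs0
    · rw [zero_add, expProfile_zero_left, one_mul]
    · have : s + t ≠ 0 := by positivity
      simp [expProfile, hs0.ne', this]
  · rw [expProfile_of_ne hr, expProfile_of_ne hr, expProfile_of_ne hr, ← Real.exp_add]
    congr 1; ring

/-- From e^{t/r} ≥ t/r; this gives continuity of the profile at r = 0. -/
theorem expProfile_le_mul {t r : ℝ} (ht : 0 < t) (hr : 0 ≤ r) :
    expProfile t r ≤ Real.exp t / t * r := by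
  rcases hr.eq_or_lt with rfl | hr0
  · simp [expProfile, ht.ne']
  · rw [expProfile_of_ne hr0.ne', show -t * (r⁻¹ - 1) = t - t / r by field_simp; ring, Real.exp_sub,
      div_mul_eq_mul_div, div_le_div_iff₀ (Real.exp_pos _) ht, mul_assoc]
    refine mul_le_mul_of_nonneg_left ?_ (Real.exp_pos _).le
    have h1 := Real.add_one_le_exp (t / r)
    calc t = r * (t / r) := by field_simp
      _ ≤ r * Real.exp (t / r) := mul_le_mul_of_nonneg_left (by linarith) hr

theorem continuousOn_expProfile {t : ℝ} (ht : 0 ≤ t) :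
    ContinuousOn (expProfile t) (Set.Ici 0) := by
  rcases ht.eq_or_lt with rfl | ht0
  · exact continuousOn_const.congr fun r _ => expProfile_zero_left r
  intro r hr
  rcases (Set.mem_Ici.mp hr).eq_or_lt with rfl | hr0
  · have h0 : expProfile t 0 = 0 := by simp [expProfile, ht0.ne']
    rw [ContinuousWithinAt, h0]
    have h1 : Tendsto (fun r : ℝ => Real.exp t / t * r) (𝓝[Set.Ici 0] 0) (𝓝 0) := by
      have : Tendsto (fun r : ℝ => Real.exp t / t * r) (𝓝 0) (𝓝 (Real.exp t / t * 0)) :=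
        (continuous_const.mul continuous_id).tendsto 0
      rw [mul_zero] at this
      exact this.mono_left nhdsWithin_le_nhds
    refine tendsto_of_tendsto_of_tendsto_of_le_of_le' tendsto_const_nhds h1
      (Eventually.of_forall fun r => expProfile_nonneg t r) ?_
    filter_upwards [self_mem_nhdsWithin] with r hr
    exact expProfile_le_mul ht0 hr
  · refine ContinuousAt.continuousWithinAt ?_
    have h1 : ContinuousAt (fun r : ℝ => Real.exp (-t * (r⁻¹ - 1))) r := by
      have := continuousAt_inv₀ hr0.ne'
      fun_prop
    refine h1.congr ?_
    filter_upwards [isOpen_ne.mem_nhds hr0.ne'] with s hs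
    exact (expProfile_of_ne hs t).symm

theorem abs_expProfile_sub_one_mul_le {t r : ℝ} (ht : 0 ≤ t) (hr : 0 ≤ r) (hr1 : r ≤ 1) :
    |(expProfile t r - 1) * r| ≤ t := by
  rcases hr.eq_or_lt with rfl | hr0
  · simpa using ht
  have h1 := expProfile_le_one ht hr hr1
  have h2 : 1 - t * (r⁻¹ - 1) ≤ expProfile t r := by
    rw [expProfile_of_ne hr0.ne']
    have := Real.add_one_le_exp (-t * (r⁻¹ - 1))
    linarith
  rw [abs_le]
  have h3 : (1 - t * (r⁻¹ - 1) - 1) * r = -t * (1 - r) := by field_simp; ring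
  have h4 : (1 - t * (r⁻¹ - 1) - 1) * r ≤ (expProfile t r - 1) * r :=
    mul_le_mul_of_nonneg_right (by linarith) hr
  constructor
  · nlinarith
  · nlinarith

/-- `a (x + a)⁻¹` as a function of `r = (1 + x)⁻¹`. -/
def eulerProfile (a r : ℝ) : ℝ := a * (r * (1 + (a - 1) * r)⁻¹)

theorem eulerProfile_denom_pos {a r : ℝ} (ha : 0 < a) (hr : 0 ≤ r) (hr1 : r ≤ 1) :
    0 < 1 + (a - 1) * r := by
  rcases hr.eq_or_lt with rfl | hr0
  · simp
  · nlinarith [mul_pos ha hr0]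

theorem eulerProfile_nonneg {a r : ℝ} (ha : 0 < a) (hr : 0 ≤ r) (hr1 : r ≤ 1) :
    0 ≤ eulerProfile a r := by
  have := eulerProfile_denom_pos ha hr hr1
  unfold eulerProfile; positivity

theorem eulerProfile_le_one {a r : ℝ} (ha : 0 < a) (hr : 0 ≤ r) (hr1 : r ≤ 1) :
    eulerProfile a r ≤ 1 := by
  have := eulerProfile_denom_pos ha hr hr1
  rw [eulerProfile, ← mul_assoc, ← div_eq_mul_inv, div_le_one this]
  linarith

theorem continuousOn_inv_denom {a : ℝ} (ha : 0 < a) :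
    ContinuousOn (fun r : ℝ => (1 + (a - 1) * r)⁻¹) (Set.Icc 0 1) := by
  refine ContinuousOn.inv₀ (by fun_prop) fun r hr => ?_
  exact (eulerProfile_denom_pos ha hr.1 hr.2).ne'

theorem continuousOn_eulerProfile {a : ℝ} (ha : 0 < a) :
    ContinuousOn (eulerProfile a) (Set.Icc 0 1) :=
  continuousOn_const.mul (continuousOn_id.mul (continuousOn_inv_denom ha))

theorem abs_inv_one_add_sub_exp_neg_le {y : ℝ} (hy : 0 ≤ y) :
    |(1 + y)⁻¹ - Real.exp (-y)| ≤ y ^ 2 := by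
  have h0 : 0 < 1 + y := by linarith
  have h1 : Real.exp (-y) ≤ (1 + y)⁻¹ := by
    rw [Real.exp_neg]
    exact inv_anti₀ h0 (by linarith [Real.add_one_le_exp y])
  have h2 := Real.add_one_le_exp (-y)
  rw [abs_of_nonneg (by linarith)]
  have h3 : (1 + y)⁻¹ ≤ 1 - y + y ^ 2 := by
    rw [inv_eq_one_div, div_le_iff₀ h0]
    nlinarith [pow_nonneg hy 3]
  linarith

/-- With y = t(r⁻¹ - 1)/n the two terms are (1 + y)⁻ⁿ and e^{-ny}, which differ by at most n y². The
factor r² cancels the growth of y² as r → 0, and the bound becomes uniform in r. -/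
theorem abs_eulerProfile_pow_sub_le {t r : ℝ} (ht : 0 < t) (hr : 0 ≤ r) (hr1 : r ≤ 1) {n : ℕ}
    (hn : 0 < n) : |(eulerProfile (n / t) r ^ n - expProfile t r) * r ^ 2| ≤ t ^ 2 / n := by
  have hn' : (0 : ℝ) < n := by exact_mod_cast hn
  rcases hr.eq_or_lt with rfl | hr0
  · simp; positivity
  have ha : 0 < (n : ℝ) / t := by positivity
  have hx : 0 ≤ r⁻¹ - 1 := sub_nonneg.mpr ((one_le_inv₀ hr0).mpr hr1)
  set y := t * (r⁻¹ - 1) / n with hy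
  have hy0 : 0 ≤ y := by positivity
  have e1 : eulerProfile (n / t) r = (1 + y)⁻¹ := by
    have h1 := eulerProfile_denom_pos ha hr hr1
    have h2 : 0 < 1 + y := by linarith
    refine eq_inv_of_mul_eq_one_left ?_
    rw [eulerProfile, ← mul_assoc, ← div_eq_mul_inv,
      div_mul_eq_mul_div, div_eq_one_iff_eq h1.ne', hy]
    field_simp
    ring
  have e2 : expProfile t r = Real.exp (-y) ^ n := by
    rw [expProfile_of_ne hr0.ne', ← Real.exp_nat_mul, hy]
    congr 1; field_simp
  have hA0 : 0 ≤ (1 + y)⁻¹ := by positivity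
  have hA1 : (1 + y)⁻¹ ≤ 1 := inv_le_one_of_one_le₀ (by linarith)
  have hB1 : Real.exp (-y) ≤ 1 := Real.exp_le_one_iff.mpr (by linarith)
  have h1 := abs_pow_sub_pow_le (1 + y)⁻¹ (Real.exp (-y)) n
  have h2 : max |(1 + y)⁻¹| |Real.exp (-y)| ^ (n - 1) ≤ 1 := by
    refine pow_le_one₀ (by positivity) ?_
    rw [abs_of_nonneg hA0, abs_of_nonneg (Real.exp_pos _).le]
    exact max_le hA1 hB1
  have h3 : |(1 + y)⁻¹ ^ n - Real.exp (-y) ^ n| ≤ y ^ 2 * n := by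
    refine h1.trans ?_
    calc _ ≤ |(1 + y)⁻¹ - Real.exp (-y)| * n * 1 := by gcongr
      _ ≤ _ := by
        rw [mul_one]
        exact mul_le_mul_of_nonneg_right (abs_inv_one_add_sub_exp_neg_le hy0) hn'.le
  rw [e1, e2, abs_mul, abs_of_nonneg (sq_nonneg r)]
  calc _ ≤ y ^ 2 * n * r ^ 2 := mul_le_mul_of_nonneg_right h3 (sq_nonneg r)
    _ = t ^ 2 / n * (1 - r) ^ 2 := by rw [hy]; field_simp
    _ ≤ t ^ 2 / n * 1 := by
      refine mul_le_mul_of_nonneg_left ?_ (by positivity)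
      nlinarith
    _ = _ := mul_one _

/-! ### The semigroup generated through the resolvent -/

section Semigroup

theorem tendsto_apply_of_denseRange {F : Type*} [NormedAddCommGroup F] [NormedSpace ℂ F]
    {ι E : Type*} {l : Filter ι} {T : ι → F →L[ℂ] F} {S : F →L[ℂ] F} {B : ℝ}
    (hT : ∀ᶠ i in l, ‖T i‖ ≤ B) (hS : ‖S‖ ≤ B) {A : E → F} (hA : DenseRange A)
    (h : ∀ x, Tendsto (fun i => T i (A x)) l (𝓝 (S (A x)))) (x : F) :
    Tendsto (fun i => T i x) l (𝓝 (S x)) := by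
  have hB : 0 ≤ B := (norm_nonneg _).trans hS
  rw [Metric.tendsto_nhds]
  intro ε hε
  -- B + 1 rather than B, which may vanish.
  obtain ⟨y, hy⟩ := hA.exists_dist_lt x (ε := ε / (3 * (B + 1))) (by positivity)
  have hy' : B * dist x (A y) < ε / 3 := by
    calc B * dist x (A y) ≤ (B + 1) * dist x (A y) := by gcongr; linarith
      _ < (B + 1) * (ε / (3 * (B + 1))) := mul_lt_mul_of_pos_left hy (by positivity)
      _ = ε / 3 := by field_simp
  filter_upwards [hT, Metric.tendsto_nhds.mp (h y) (ε / 3) (by positivity)] with i hi hi'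
  have h1 : dist (T i x) (T i (A y)) ≤ B * dist x (A y) := by
    rw [dist_eq_norm, dist_eq_norm, ← map_sub]
    exact (T i).le_of_opNorm_le hi _
  have h2 : dist (S (A y)) (S x) ≤ B * dist x (A y) := by
    rw [dist_comm, dist_eq_norm, dist_eq_norm, ← map_sub]
    exact S.le_of_opNorm_le hS _
  have := dist_triangle4 (T i x) (T i (A y)) (S (A y)) (S x)
  linarith

/-- A locally bounded semigroup that is continuous at `0` on a dense set is strongly continuous. -/
theorem continuous_semigroup_of_denseRange {F : Type*} [NormedAddCommGroup F] [NormedSpace ℂ F]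
    {E : Type*} {T : ℝ≥0 → F →L[ℂ] F} (h0 : T 0 = ContinuousLinearMap.id ℂ F)
    (hadd : ∀ s t, T (s + t) = (T s).comp (T t)) {w : ℝ}
    (hT : ∀ t : ℝ≥0, ‖T t‖ ≤ Real.exp (w * t)) {A : E → F} (hA : DenseRange A)
    (h : ∀ x, Tendsto (fun t => T t (A x)) (𝓝 0) (𝓝 (A x))) (x : F) :
    Continuous fun t => T t x := by
  -- The sign of w is unknown; |w| gives a bound that is monotone in time.
  have hbd : ∀ r t : ℝ≥0, t ≤ r → ‖T t‖ ≤ Real.exp (|w| * r) := by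
    intro r t ht
    refine (hT t).trans (Real.exp_le_exp.mpr ?_)
    have ht' : (t : ℝ) ≤ r := ht
    exact mul_le_mul (le_abs_self w) ht' t.2 (abs_nonneg w)
  have hzero : Tendsto (fun t => T t x) (𝓝 0) (𝓝 x) := by
    refine tendsto_apply_of_denseRange (S := ContinuousLinearMap.id ℂ F)
      (B := Real.exp (|w| * (1 : ℝ≥0))) ?_ ?_ hA h x
    · filter_upwards [Iic_mem_nhds (show (0 : ℝ≥0) < 1 from zero_lt_one)] with t ht
      exact hbd 1 t ht
    · rw [← h0]; exact hbd 1 0 zero_le_one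
  rw [continuous_iff_continuousAt]
  intro r
  rw [ContinuousAt, tendsto_iff_norm_sub_tendsto_zero]
  have h1 : Tendsto (fun s => T (s - r) x) (𝓝 r) (𝓝 x) := by
    refine hzero.comp ?_
    have : Continuous fun s : ℝ≥0 => s - r := by fun_prop
    simpa using this.tendsto r
  have h2 : Tendsto (fun s => T (r - s) x) (𝓝 r) (𝓝 x) := by
    refine hzero.comp ?_
    have : Continuous fun s : ℝ≥0 => r - s := by fun_prop
    simpa using this.tendsto r
  have h3 := ((h1.sub h2).norm).const_mul (Real.exp (|w| * r))
  rw [sub_self, norm_zero, mul_zero] at h3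
  refine squeeze_zero (fun _ => norm_nonneg _) (fun s => ?_) h3
  -- Truncated subtraction treats both sides of r at once: one of s - r and r - s is always 0.
  have e1 : T s x = T (min s r) (T (s - r) x) := by
    rw [← ContinuousLinearMap.comp_apply, ← hadd]
    congr 2
    rcases le_total s r with hsr | hsr
    · rw [min_eq_left hsr, tsub_eq_zero_of_le hsr, add_zero]
    · rw [min_eq_right hsr, add_tsub_cancel_of_le hsr]
  have e2 : T r x = T (min s r) (T (r - s) x) := by
    rw [← ContinuousLinearMap.comp_apply, ← hadd]
    congr 2
    rcases le_total s r with hsr | hsr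
    · rw [min_eq_left hsr, add_tsub_cancel_of_le hsr]
    · rw [min_eq_right hsr, tsub_eq_zero_of_le hsr, add_zero]
  rw [e1, e2, ← map_sub]
  exact (T (min s r)).le_of_opNorm_le (hbd r _ (min_le_right _ _)) _

variable {F : Type*} [NormedAddCommGroup F] [InnerProductSpace ℂ F]

variable [CompleteSpace F] {R : F →L[ℂ] F}

/-- `exp(-tA)` in terms of the resolvent `R = (A + 1)⁻¹`. -/
def expResolvent (R : F →L[ℂ] F) (t : ℝ) : F →L[ℂ] F := cfc (expProfile t) R

theorem spectrum_subset_Icc (hR : R.IsPositive) (h1 : ‖R‖ ≤ 1) :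
    spectrum ℝ R ⊆ Set.Icc 0 1 := by
  intro r hr
  refine ⟨spectrum_nonneg_of_nonneg ((ContinuousLinearMap.nonneg_iff_isPositive _).mpr hR) hr, ?_⟩
  rcases subsingleton_or_nontrivial F with hs | hn
  · have : Subsingleton (F →L[ℂ] F) := inferInstance
    rw [spectrum.of_subsingleton] at hr
    exact hr.elim
  · exact (Real.le_norm_self r).trans ((spectrum.norm_le_norm_of_mem hr).trans h1)

theorem continuousOn_expProfile_spectrum (hR : R.IsPositive) (h1 : ‖R‖ ≤ 1) {t : ℝ} (ht : 0 ≤ t) :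
    ContinuousOn (expProfile t) (spectrum ℝ R) :=
  (continuousOn_expProfile ht).mono fun _ hr => (spectrum_subset_Icc hR h1 hr).1

theorem expResolvent_zero (hR : R.IsPositive) : expResolvent R 0 = 1 := by
  have : expProfile 0 = fun _ => 1 := funext expProfile_zero_left
  rw [expResolvent, this]
  exact cfc_const_one ℝ R hR.isSelfAdjoint

theorem expResolvent_add (hR : R.IsPositive) (h1 : ‖R‖ ≤ 1) {s t : ℝ} (hs : 0 ≤ s)
    (ht : 0 ≤ t) :
    expResolvent R (s + t) = expResolvent R s * expResolvent R t := by
  rw [expResolvent, expResolvent, expResolvent, ← cfc_mul _ _ R (continuousOn_expProfile_spectrum hR h1 hs)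
    (continuousOn_expProfile_spectrum hR h1 ht)]
  exact cfc_congr fun r _ => expProfile_add hs ht r

theorem norm_cfc_expProfile_le (hR : R.IsPositive) (h1 : ‖R‖ ≤ 1) {t : ℝ} (ht : 0 ≤ t) :
    ‖cfc (expProfile t) R‖ ≤ 1 := by
  refine norm_cfc_le zero_le_one fun r hr => ?_
  obtain ⟨h2, h3⟩ := spectrum_subset_Icc hR h1 hr
  rw [Real.norm_of_nonneg (expProfile_nonneg _ _)]
  exact expProfile_le_one ht h2 h3

theorem norm_cfc_expProfile_mul_sub_le (hR : R.IsPositive) (h1 : ‖R‖ ≤ 1) {t : ℝ} (ht : 0 ≤ t) :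
    ‖cfc (expProfile t) R * R - R‖ ≤ t := by
  have hc := continuousOn_expProfile_spectrum hR h1 ht
  have e : cfc (fun r => (expProfile t r - 1) * r) R = cfc (expProfile t) R * R - R := by
    rw [cfc_mul (fun r => expProfile t r - 1) (fun r => r) R (hc.sub continuousOn_const),
      cfc_sub (expProfile t) (fun _ => 1) R hc, cfc_const_one ℝ R hR.isSelfAdjoint,
      cfc_id' ℝ R hR.isSelfAdjoint, sub_mul, one_mul]
  rw [← e]
  refine norm_cfc_le ht fun r hr => ?_
  obtain ⟨h2, h3⟩ := spectrum_subset_Icc hR h1 hr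
  exact abs_expProfile_sub_one_mul_le ht h2 h3

theorem tendsto_expResolvent_apply (hR : R.IsPositive) (h1 : ‖R‖ ≤ 1) (hd : DenseRange R)
    (f : F) : Tendsto (fun t : ℝ≥0 => expResolvent R t f) (𝓝 0) (𝓝 f) := by
  refine tendsto_apply_of_denseRange (S := ContinuousLinearMap.id ℂ F)
    (Eventually.of_forall fun t => norm_cfc_expProfile_le hR h1 t.2)
    ContinuousLinearMap.norm_id_le hd (fun x => ?_) f
  rw [tendsto_iff_norm_sub_tendsto_zero]
  have h0 : Tendsto (fun t : ℝ≥0 => (t : ℝ) * ‖x‖) (𝓝 0) (𝓝 0) := by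
    have : Continuous fun t : ℝ≥0 => (t : ℝ) * ‖x‖ := by fun_prop
    simpa using this.tendsto 0
  refine squeeze_zero (fun _ => norm_nonneg _) (fun t => ?_) h0
  exact (cfc (expProfile t) R * R - R).le_of_opNorm_le
    (norm_cfc_expProfile_mul_sub_le hR h1 t.2) x

/-- The hypothesis on S is the resolvent identity; 1 + (a - 1)r is positive on [0, 1], so the
calculus inverts it and determines S as a function of R. -/
theorem smul_eq_cfc_eulerProfile (hR : R.IsPositive) (h1 : ‖R‖ ≤ 1) {a : ℝ} (ha : 0 < a)
    {S : F →L[ℂ] F} (hS : S * (1 + (a - 1) • R) = R) : a • S = cfc (eulerProfile a) R := by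
  have hsub := spectrum_subset_Icc hR h1
  have hsa := hR.isSelfAdjoint
  have hc := (continuousOn_inv_denom ha).mono hsub
  have hlin : ContinuousOn (fun r : ℝ => 1 + (a - 1) * r) (spectrum ℝ R) := by fun_prop
  have e1 : cfc (fun r : ℝ => 1 + (a - 1) * r) R = 1 + (a - 1) • R := by
    rw [cfc_add R (fun _ => 1) (fun r => (a - 1) * r)
      continuousOn_const (by fun_prop), cfc_const_one ℝ R hsa,
      cfc_const_mul (a - 1) (fun r => r) R, cfc_id' ℝ R hsa]
  have e2 : (1 + (a - 1) • R) * cfc (fun r : ℝ => (1 + (a - 1) * r)⁻¹) R = 1 := by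
    rw [← e1, ← cfc_mul _ _ R hlin hc, ← cfc_const_one ℝ R hsa]
    refine cfc_congr fun r hr => ?_
    exact mul_inv_cancel₀ (eulerProfile_denom_pos ha (hsub hr).1 (hsub hr).2).ne'
  have e3 : S = R * cfc (fun r : ℝ => (1 + (a - 1) * r)⁻¹) R := by
    calc S = S * ((1 + (a - 1) • R) * cfc (fun r : ℝ => (1 + (a - 1) * r)⁻¹) R) := by
          rw [e2, mul_one]
      _ = _ := by rw [← mul_assoc, hS]
  have e4 : cfc (eulerProfile a) R
      = a • (R * cfc (fun r : ℝ => (1 + (a - 1) * r)⁻¹) R) := by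
    have : eulerProfile a = fun r => a * (r * (1 + (a - 1) * r)⁻¹) := rfl
    rw [this, cfc_const_mul a (fun r : ℝ => r * (1 + (a - 1) * r)⁻¹) R (continuousOn_id.mul hc),
      cfc_mul (fun r : ℝ => r) _ R continuousOn_id hc, cfc_id' ℝ R hsa]
  rw [e4, ← e3]

/-- The scalar estimate carries r², so it gives convergence on the range of R²; that range is dense
and all operators involved are eventually contractions. -/
theorem tendsto_cfc_eulerProfile_pow_apply (hR : R.IsPositive) (h1 : ‖R‖ ≤ 1)
    (hd : DenseRange R) {t : ℝ} (ht : 0 < t) (f : F) :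
    Tendsto (fun n : ℕ => (cfc (eulerProfile (n / t)) R ^ n) f) atTop
      (𝓝 (expResolvent R t f)) := by
  have hsub := spectrum_subset_Icc hR h1
  have hsa := hR.isSelfAdjoint
  have hcont : ∀ n : ℕ, 0 < n → ContinuousOn (eulerProfile (n / t)) (spectrum ℝ R) := by
    intro n hn
    have : (0 : ℝ) < n := by exact_mod_cast hn
    exact (continuousOn_eulerProfile (by positivity)).mono hsub
  have hpow : ∀ n : ℕ, 0 < n → cfc (eulerProfile (n / t)) R ^ n
      = cfc (fun r => eulerProfile (n / t) r ^ n) R := fun n hn =>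
    (cfc_pow (eulerProfile (n / t)) n R (hcont n hn) hsa).symm
  have hce := continuousOn_expProfile_spectrum hR h1 ht.le
  refine tendsto_apply_of_denseRange (A := fun x => R (R x)) ?_
    (norm_cfc_expProfile_le hR h1 ht.le) (hd.comp hd R.continuous) (fun x => ?_) f
  · filter_upwards [eventually_gt_atTop 0] with n hn
    have : (0 : ℝ) < n := by exact_mod_cast hn
    rw [hpow n hn]
    refine norm_cfc_le zero_le_one fun r hr => ?_
    have h0 := eulerProfile_nonneg (a := n / t) (by positivity) (hsub hr).1 (hsub hr).2
    rw [norm_pow, Real.norm_of_nonneg h0]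
    exact pow_le_one₀ h0 (eulerProfile_le_one (by positivity) (hsub hr).1 (hsub hr).2)
  · rw [tendsto_iff_norm_sub_tendsto_zero]
    have h0 : Tendsto (fun n : ℕ => t ^ 2 / n * ‖x‖) atTop (𝓝 0) := by
      simpa using (tendsto_const_div_atTop_nhds_zero_nat (t ^ 2)).mul_const ‖x‖
    refine squeeze_zero' (Eventually.of_forall fun _ => norm_nonneg _) ?_ h0
    filter_upwards [eventually_gt_atTop 0] with n hn
    have e : cfc (fun r => (eulerProfile (n / t) r ^ n - expProfile t r) * r ^ 2) R
        = (cfc (eulerProfile (n / t)) R ^ n - cfc (expProfile t) R) * (R * R) := by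
      rw [cfc_mul (fun r => eulerProfile (n / t) r ^ n - expProfile t r) (fun r => r ^ 2) R
          (((hcont n hn).pow n).sub hce) (by fun_prop),
        cfc_sub (fun r => eulerProfile (n / t) r ^ n) (expProfile t) R ((hcont n hn).pow n) hce,
        hpow n hn, cfc_pow_id R 2 hsa, sq]
    have hle : ‖(cfc (eulerProfile (n / t)) R ^ n - cfc (expProfile t) R) * (R * R)‖
        ≤ t ^ 2 / n := by
      rw [← e]
      refine norm_cfc_le (by positivity) fun r hr => ?_
      exact abs_eulerProfile_pow_sub_le ht (hsub hr).1 (hsub hr).2 hn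
    exact ContinuousLinearMap.le_of_opNorm_le _ hle x

/-- The exponential formula `exp(-tA) = lim ((n/t) (A + n/t)⁻¹)ⁿ`. -/
theorem tendsto_smul_pow_apply (hR : R.IsPositive) (h1 : ‖R‖ ≤ 1) (hd : DenseRange R) {t : ℝ}
    (ht : 0 < t) {S : ℕ → F →L[ℂ] F}
    (hS : ∀ n : ℕ, S n * (1 + (((n + 1 : ℕ) : ℝ) / t - 1) • R) = R) (f : F) :
    Tendsto (fun n : ℕ => (((((n + 1 : ℕ) : ℝ) / t) • S n) ^ (n + 1)) f) atTop
      (𝓝 (expResolvent R t f)) := by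
  -- The shift to n + 1 keeps the parameter (n + 1)/t positive for every index.
  refine ((tendsto_add_atTop_iff_nat 1).mpr
    (tendsto_cfc_eulerProfile_pow_apply hR h1 hd ht f)).congr fun n => ?_
  rw [smul_eq_cfc_eulerProfile hR h1 (by positivity) (hS n)]

end Semigroup

namespace MagneticSchrodingerGraph

variable {X : Type*} (G : MagneticSchrodingerGraph X) (hG : G.IsPositive)

/-! ### The semigroup on `ℓ²` -/

theorem norm_resolvent_one_le : ‖G.resolvent hG one_pos‖ ≤ 1 := by
  have h := LinearMap.opNorm_extendOfNorm_le (G.denseRange_toFormDomain hG one_pos)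
    (f := G.toEll2) (C := (√1)⁻¹) (by positivity) (G.norm_toEll2_le hG one_pos)
  rw [Real.sqrt_one, inv_one] at h
  rw [← norm_formIncl_sq]
  exact pow_le_one₀ (ContinuousLinearMap.opNorm_nonneg _) h

theorem denseRange_resolvent {a : ℝ} (ha : 0 < a) : DenseRange (G.resolvent hG ha) := by
  have h : (G.resolvent hG ha).range.topologicalClosure = ⊤ := by
    rw [Submodule.topologicalClosure_eq_top_iff, Submodule.eq_bot_iff]
    intro f hf
    refine (injective_iff_map_eq_zero _).mp (G.resolvent_injective hG ha) f ?_
    refine ext_inner_left ℂ fun x => ?_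
    have h1 := (Submodule.mem_orthogonal _ _).mp hf (G.resolvent hG ha x) ⟨x, rfl⟩
    have h2 := ContinuousLinearMap.adjoint_inner_right (G.resolvent hG ha) x f
    rw [(G.isPositive_resolvent hG ha).isSelfAdjoint.adjoint_eq, h1] at h2
    rw [h2, inner_zero_right]
  exact Submodule.dense_iff_topologicalClosure_eq_top.mpr h

/-- If x = (H + 1)⁻¹y then (H + a)x = y + (a - 1)x. -/
theorem resolvent_mul {a : ℝ} (ha : 0 < a) :
    G.resolvent hG ha * (1 + (a - 1) • G.resolvent hG one_pos) = G.resolvent hG one_pos := by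
  ext1 y
  set x := G.resolvent hG one_pos y with hx
  have hu : (x, y - x) ∈ G.opGraph hG := by
    rw [G.mem_opGraph_iff hG one_pos, Complex.ofReal_one, one_smul, sub_add_cancel]
  have h := (G.mem_opGraph_iff hG ha).mp hu
  have e : (1 + (a - 1) • G.resolvent hG one_pos) y = y - x + (a : ℂ) • x := by
    change y + (a - 1) • x = _
    rw [sub_smul, one_smul, Complex.coe_smul, sub_add_eq_add_sub, add_sub_assoc]
    rfl
  rw [mul_apply_eq_comp, e]
  exact h

theorem S2_eq (t : ℝ≥0) : G.S2 hG t = expResolvent (G.resolvent hG one_pos) t := by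
  rw [← pmapResolvent_H]
  rfl

theorem S2_zero : G.S2 hG 0 = ContinuousLinearMap.id ℂ (G.ell 2) := by
  rw [S2_eq]
  exact expResolvent_zero (G.isPositive_resolvent hG one_pos)

theorem S2_add (s t : ℝ≥0) : G.S2 hG (s + t) = (G.S2 hG s).comp (G.S2 hG t) := by
  rw [S2_eq, S2_eq, S2_eq, NNReal.coe_add]
  exact expResolvent_add (G.isPositive_resolvent hG one_pos) (G.norm_resolvent_one_le hG) s.2 t.2

theorem tendsto_S2_zero (f : G.ell 2) : Tendsto (fun t => G.S2 hG t f) (𝓝 0) (𝓝 f) := by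
  simp only [S2_eq]
  exact tendsto_expResolvent_apply (G.isPositive_resolvent hG one_pos)
    (G.norm_resolvent_one_le hG) (G.denseRange_resolvent hG one_pos) f

section Bound

variable {M C p : ℝ}

/-- Iterates the resolvent bound; each bound also supplies the membership in ℓ^p that the next step
requires. -/
theorem eLpNorm_smul_resolvent_pow_le (hc : G.IsFormBounded M C) (hp : 1 < p)
    (hM : 0 ≤ Cconst p - M * (1 - Cconst p)) {a : ℝ} (ha : 0 < a)
    (hκ : 0 < a + Dconst M C (G.lam2 hG) p) (f : G.ell 2)
    (hf : MemLp f (ENNReal.ofReal p) G.measure) (n : ℕ) :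
    eLpNorm (((a • G.resolvent hG ha) ^ n) f) (ENNReal.ofReal p) G.measure ≤
      ENNReal.ofReal ((a / (a + Dconst M C (G.lam2 hG) p)) ^ n) *
        eLpNorm f (ENNReal.ofReal p) G.measure := by
  set D := Dconst M C (G.lam2 hG) p with hD
  have hq : 0 ≤ a / (a + D) := (div_pos ha hκ).le
  induction n with
  | zero => simp
  | succ n ih =>
    set g := ((a • G.resolvent hG ha) ^ n) f with hg
    have hgm : MemLp g (ENNReal.ofReal p) G.measure :=
      ⟨G.aestronglyMeasurable_measure _,
        ih.trans_lt (ENNReal.mul_lt_top ENNReal.ofReal_lt_top hf.2)⟩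
    have e : ((a • G.resolvent hG ha) ^ (n + 1)) f = a • G.resolvent hG ha g := by
      rw [pow_succ']; rfl
    rw [e, eLpNorm_congr_ae (Lp.coeFn_smul a _)]
    calc eLpNorm (a • ⇑(G.resolvent hG ha g)) (ENNReal.ofReal p) G.measure
        ≤ ENNReal.ofReal a * eLpNorm (G.resolvent hG ha g) (ENNReal.ofReal p) G.measure := by
          refine eLpNorm_const_smul_le.trans (le_of_eq ?_)
          rw [Real.enorm_of_nonneg ha.le]
      _ ≤ ENNReal.ofReal a * (ENNReal.ofReal ((a + D)⁻¹) *
            eLpNorm g (ENNReal.ofReal p) G.measure) := by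
          gcongr
          exact G.eLpNorm_resolvent_le hG ha hc hp hM hκ g hgm
      _ ≤ ENNReal.ofReal a * (ENNReal.ofReal ((a + D)⁻¹) *
            (ENNReal.ofReal ((a / (a + D)) ^ n) * eLpNorm f (ENNReal.ofReal p) G.measure)) := by
          gcongr
      _ = _ := by
          rw [← mul_assoc, ← mul_assoc, ← ENNReal.ofReal_mul ha.le,
            ← ENNReal.ofReal_mul (mul_nonneg ha.le (inv_nonneg.mpr hκ.le)), ← div_eq_mul_inv,
            ← pow_succ']

theorem eLpNorm_S2_le (hc : G.IsFormBounded M C) (hp : 1 < p)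
    (hM : 0 ≤ Cconst p - M * (1 - Cconst p)) (t : ℝ≥0) (f : G.ell 2)
    (hf : MemLp f (ENNReal.ofReal p) G.measure) :
    eLpNorm (G.S2 hG t f) (ENNReal.ofReal p) G.measure ≤
      ENNReal.ofReal (Real.exp (-Dconst M C (G.lam2 hG) p * t)) *
        eLpNorm f (ENNReal.ofReal p) G.measure := by
  rcases eq_or_ne t 0 with rfl | ht0
  · simp [S2_zero]
  have ht : 0 < (t : ℝ) := by exact_mod_cast pos_iff_ne_zero.mpr ht0
  set D := Dconst M C (G.lam2 hG) p with hD
  set B := (eLpNorm f (ENNReal.ofReal p) G.measure).toReal with hB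
  have hB0 : 0 ≤ B := ENNReal.toReal_nonneg
  have hBf : eLpNorm f (ENNReal.ofReal p) G.measure = ENNReal.ofReal B :=
    (ENNReal.ofReal_toReal hf.2.ne).symm
  have ha : ∀ n : ℕ, 0 < ((n + 1 : ℕ) : ℝ) / t := fun n => by positivity
  have hlim := tendsto_smul_pow_apply (G.isPositive_resolvent hG one_pos)
    (G.norm_resolvent_one_le hG) (G.denseRange_resolvent hG one_pos) ht
    (S := fun n => G.resolvent hG (ha n)) (fun n => G.resolvent_mul hG (ha n)) f
  rw [← S2_eq] at hlim
  have hrate : Tendsto (fun n : ℕ => ((1 + D * t / (n + 1 : ℕ)) ^ (n + 1))⁻¹ * B) atTop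
      (𝓝 (Real.exp (-D * t) * B)) := by
    rw [neg_mul, Real.exp_neg]
    exact (((tendsto_add_atTop_iff_nat 1).mpr (Real.tendsto_one_add_div_pow_exp (D * t))).inv₀
      (Real.exp_pos _).ne').mul_const B
  -- D may be negative, so the resolvent bound is available only for large n.
  have hev : ∀ᶠ n : ℕ in atTop, 0 < ((n + 1 : ℕ) : ℝ) / t + D := by
    have : Tendsto (fun n : ℕ => (n : ℝ) / t + D) atTop atTop :=
      tendsto_atTop_add_const_right _ _ (tendsto_natCast_atTop_atTop.atTop_div_const ht)
    exact ((tendsto_add_atTop_iff_nat 1).mpr this).eventually_gt_atTop 0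
  have hq : ∀ n : ℕ, ((1 + D * t / (n + 1 : ℕ)) ^ (n + 1))⁻¹
      = ((((n + 1 : ℕ) : ℝ) / t) / (((n + 1 : ℕ) : ℝ) / t + D)) ^ (n + 1) := by
    intro n
    have h0 : (0 : ℝ) < (n + 1 : ℕ) := by positivity
    rw [← inv_pow]
    congr 1
    generalize ((n + 1 : ℕ) : ℝ) = k at h0
    have : 1 + D * t / k = (k / t + D) / (k / t) := by field_simp
    rw [this, inv_div]
  rw [hBf, ← ENNReal.ofReal_mul (Real.exp_pos _).le]
  refine G.eLpNorm_le_of_tendsto hp.le (l := atTop)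
    (fun x => ((G.continuous_eval x).tendsto _).comp hlim) hrate ?_ ?_
  · filter_upwards [hev] with n hn
    rw [hq]
    exact mul_nonneg (pow_nonneg (div_pos (ha n) hn).le _) hB0
  · filter_upwards [hev] with n hn
    rw [hq, ENNReal.ofReal_mul (pow_nonneg (div_pos (ha n) hn).le _), ← hBf]
    exact G.eLpNorm_smul_resolvent_pow_le hG hc hp hM (ha n) hn f hf (n + 1)

end Bound

/-! ### The semigroup on `ℓ^p` -/

/-- Pointwise convergence together with convergence of the norms to the norm of a finitely
supported limit gives convergence in `ℓ^p`. -/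
theorem tendsto_toEll_of_pointwise {p : ℝ} (hp : 1 ≤ p) [Fact (1 ≤ ENNReal.ofReal p)]
    {ι : Type*} {l : Filter ι} {g : ι → G.ell (ENNReal.ofReal p)} {φ : X →₀ ℂ}
    (hg : ∀ x, Tendsto (fun i => g i x) l (𝓝 (φ x))) {B : ι → ℝ} (hB : Tendsto B l (𝓝 1))
    (hgB : ∀ i, ‖g i‖ ≤ B i * ‖G.toEll (ENNReal.ofReal p) φ‖) :
    Tendsto g l (𝓝 (G.toEll (ENNReal.ofReal p) φ)) := by
  classical
  have hp0 : 0 < p := by linarith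
  set K := φ.support
  set ν := ‖G.toEll (ENNReal.ofReal p) φ‖ with hν
  have hterm : ∀ (x : X) (z : ℂ), 0 ≤ G.m x * ‖z‖ ^ p := fun x z =>
    mul_nonneg (G.m_pos x).le (Real.rpow_nonneg (norm_nonneg _) _)
  have hφ0 : ∀ x, x ∉ K → φ x = 0 := fun x hx => Finsupp.notMem_support_iff.mp hx
  set N := ∑ x ∈ K, G.m x * ‖φ x‖ ^ p with hN
  have hN0 : 0 ≤ N := Finset.sum_nonneg fun x _ => hterm x _
  have hνN : ν ^ p ≤ N := by
    have h1 : ν ≤ N ^ p⁻¹ := by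
      rw [hν, G.norm_le_iff hp _ (by positivity), Real.rpow_inv_rpow hN0 hp0.ne']
      intro L
      rw [coeFn_toEll]
      calc ∑ x ∈ L, G.m x * ‖φ x‖ ^ p ≤ ∑ x ∈ L ∪ K, G.m x * ‖φ x‖ ^ p :=
            Finset.sum_le_sum_of_subset_of_nonneg Finset.subset_union_left fun x _ _ => hterm x _
        _ = N := (Finset.sum_subset Finset.subset_union_right fun x _ hx => by
            rw [hφ0 x hx, norm_zero, Real.zero_rpow hp0.ne', mul_zero]).symm
    calc ν ^ p ≤ (N ^ p⁻¹) ^ p := Real.rpow_le_rpow (norm_nonneg _) h1 hp0.le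
      _ = N := Real.rpow_inv_rpow hN0 hp0.ne'
  set α : ι → ℝ := fun i => ∑ x ∈ K, G.m x * ‖g i x - φ x‖ ^ p with hα
  -- An upper bound for the mass of g i off K: the largest possible total minus the part on K. It
  -- tends to 0 because the part on K already converges to N.
  set β : ι → ℝ := fun i => |B i| ^ p * N - ∑ x ∈ K, G.m x * ‖g i x‖ ^ p with hβ
  have hα0 : Tendsto α l (𝓝 0) := by
    have : Tendsto α l (𝓝 (∑ x ∈ K, G.m x * ‖φ x - φ x‖ ^ p)) :=
      tendsto_finsetSum _ fun x _ =>
        (((hg x).sub_const _).norm.rpow_const (Or.inr hp0.le)).const_mul _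
    simpa [Real.zero_rpow hp0.ne'] using this
  have hβ0 : Tendsto β l (𝓝 0) := by
    have h1 : Tendsto (fun i => |B i| ^ p * N) l (𝓝 (|1| ^ p * N)) :=
      (hB.abs.rpow_const (Or.inr hp0.le)).mul_const N
    have h2 : Tendsto (fun i => ∑ x ∈ K, G.m x * ‖g i x‖ ^ p) l (𝓝 N) :=
      tendsto_finsetSum _ fun x _ => ((hg x).norm.rpow_const (Or.inr hp0.le)).const_mul _
    simpa using h1.sub h2
  have hβnn : ∀ i, ∀ L : Finset X, Disjoint L K → ∑ x ∈ L, G.m x * ‖g i x‖ ^ p ≤ β i := by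
    intro i L hL
    have h1 : ‖g i‖ ≤ |B i| * ν :=
      (hgB i).trans (mul_le_mul_of_nonneg_right (le_abs_self _) (norm_nonneg _))
    have h2 := (G.norm_le_iff hp (g i) (by positivity)).mp h1 (L ∪ K)
    rw [Finset.sum_union hL, Real.mul_rpow (abs_nonneg _) (norm_nonneg _)] at h2
    have h3 := mul_le_mul_of_nonneg_left hνN (Real.rpow_nonneg (abs_nonneg (B i)) p)
    simp only [hβ]; linarith
  have hle : ∀ i, ‖g i - G.toEll (ENNReal.ofReal p) φ‖ ≤ (α i + β i) ^ p⁻¹ := by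
    intro i
    have hα' : 0 ≤ α i := Finset.sum_nonneg fun x _ => hterm x _
    have hβ' : 0 ≤ β i := by simpa using hβnn i ∅ (Finset.disjoint_empty_left _)
    rw [G.norm_le_iff hp _ (by positivity), Real.rpow_inv_rpow (by positivity) hp0.ne']
    intro L
    rw [coeFn_sub, coeFn_toEll, ← Finset.sum_inter_add_sum_sdiff L K]
    refine add_le_add ?_ ?_
    · exact Finset.sum_le_sum_of_subset_of_nonneg Finset.inter_subset_right fun x _ _ => hterm x _
    · refine le_trans (le_of_eq ?_) (hβnn i (L \ K) Finset.sdiff_disjoint)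
      refine Finset.sum_congr rfl fun x hx => ?_
      rw [Pi.sub_apply, hφ0 x (Finset.mem_sdiff.mp hx).2, sub_zero]
  rw [tendsto_iff_norm_sub_tendsto_zero]
  refine squeeze_zero (fun _ => norm_nonneg _) hle ?_
  have := (hα0.add hβ0).rpow_const (p := p⁻¹) (Or.inr (by positivity))
  simpa [Real.zero_rpow (inv_pos.mpr hp0).ne'] using this

/-- The space `ℓ² ∩ ℓ^p`. -/
def ellInter (p : ℝ≥0∞) : Submodule ℂ (G.ell 2) where
  carrier := {f | MemLp f p G.measure}
  zero_mem' := by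
    simp only [Set.mem_ofPred_eq, coeFn_zero]
    exact MemLp.zero'
  add_mem' {f g} hf hg := by
    simp only [Set.mem_ofPred_eq, coeFn_add]
    exact MemLp.add hf hg
  smul_mem' a f hf := by
    simp only [Set.mem_ofPred_eq, coeFn_smul]
    exact MemLp.const_smul hf a

theorem memLp_ellInter {p : ℝ≥0∞} (f : G.ellInter p) : MemLp (f : G.ell 2) p G.measure := f.2

/-- The inclusion of `ℓ² ∩ ℓ^p` into `ℓ^p`. -/
def ellInterIncl (p : ℝ≥0∞) : G.ellInter p →ₗ[ℂ] G.ell p where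
  toFun f := (G.memLp_ellInter f).toLp _
  map_add' f g := G.ell_ext (by
    rw [coeFn_add, coeFn_toLp, coeFn_toLp, coeFn_toLp, Submodule.coe_add, coeFn_add])
  map_smul' a f := G.ell_ext (by
    rw [RingHom.id_apply, coeFn_smul, coeFn_toLp, coeFn_toLp, Submodule.coe_smul, coeFn_smul])

theorem coeFn_ellInterIncl {p : ℝ≥0∞} (f : G.ellInter p) :
    (G.ellInterIncl p f : X → ℂ) = (f : G.ell 2) := G.coeFn_toLp (G.memLp_ellInter f)

theorem exists_ellInter {p : ℝ≥0∞} {f : G.ell 2} {g : G.ell p} (h : (f : X → ℂ) = g) :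
    ∃ hf : f ∈ G.ellInter p, G.ellInterIncl p ⟨f, hf⟩ = g := by
  have hf : MemLp f p G.measure := h ▸ Lp.memLp g
  exact ⟨hf, G.ell_ext ((G.coeFn_ellInterIncl ⟨f, hf⟩).trans h)⟩

theorem denseRange_ellInterIncl {p : ℝ} (hp : 1 ≤ p) [Fact (1 ≤ ENNReal.ofReal p)] :
    DenseRange (G.ellInterIncl (ENNReal.ofReal p)) := by
  refine (G.denseRange_toEll hp).mono ?_
  rintro _ ⟨φ, rfl⟩
  obtain ⟨hf, h⟩ := G.exists_ellInter (f := G.toEll2 φ) (g := G.toEll (ENNReal.ofReal p) φ)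
    (by rw [coeFn_toEll2, coeFn_toEll])
  exact ⟨_, h⟩

theorem norm_ellInterIncl_le_of_eLpNorm_le {p : ℝ≥0∞} [Fact (1 ≤ p)] {f g : G.ellInter p} {B : ℝ}
    (hB : 0 ≤ B) (h : eLpNorm (f : G.ell 2) p G.measure
      ≤ ENNReal.ofReal B * eLpNorm (g : G.ell 2) p G.measure) :
    ‖G.ellInterIncl p f‖ ≤ B * ‖G.ellInterIncl p g‖ := by
  have h1 := ENNReal.toReal_mono
    (ENNReal.mul_ne_top ENNReal.ofReal_ne_top (G.memLp_ellInter g).2.ne) h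
  rwa [ENNReal.toReal_mul, ENNReal.toReal_ofReal hB, ← coeFn_ellInterIncl, ← coeFn_ellInterIncl,
    ← Lp.norm_def, ← Lp.norm_def] at h1

/-- A family of operators on `ℓ²` with exponential bounds on `ℓ² ∩ ℓ^p`, which is a semigroup and
strongly continuous at `0`, has a unique consistent extension to a semigroup on `ℓ^p`. -/
theorem existsUnique_extension {p : ℝ} (hp : 1 ≤ p) [Fact (1 ≤ ENNReal.ofReal p)] {w : ℝ}
    {S : ℝ≥0 → G.ell 2 →L[ℂ] G.ell 2} (h0 : S 0 = ContinuousLinearMap.id ℂ (G.ell 2))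
    (hadd : ∀ s t, S (s + t) = (S s).comp (S t))
    (hcont : ∀ f, Tendsto (fun t => S t f) (𝓝 0) (𝓝 f))
    (hS : ∀ (t : ℝ≥0) (f : G.ell 2), MemLp f (ENNReal.ofReal p) G.measure →
      eLpNorm (S t f) (ENNReal.ofReal p) G.measure ≤
        ENNReal.ofReal (Real.exp (w * t)) * eLpNorm f (ENNReal.ofReal p) G.measure) :
    ∃! Sp : ℝ≥0 → G.ell (ENNReal.ofReal p) →L[ℂ] G.ell (ENNReal.ofReal p),
      IsC0Semigroup Sp ∧ (∀ t : ℝ≥0, ‖Sp t‖ ≤ Real.exp (w * t)) ∧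
        ∀ (t : ℝ≥0) (f : G.ell 2) (g : G.ell (ENNReal.ofReal p)),
          (f : X → ℂ) = g → (S t f : X → ℂ) = Sp t g := by
  set q := ENNReal.ofReal p with hq
  have hmem : ∀ (t : ℝ≥0), ∀ f ∈ G.ellInter q, S t f ∈ G.ellInter q := fun t f hf =>
    ⟨G.aestronglyMeasurable_measure _,
      (hS t f hf).trans_lt (ENNReal.mul_lt_top ENNReal.ofReal_lt_top hf.2)⟩
  let L : ℝ≥0 → G.ellInter q →ₗ[ℂ] G.ell q := fun t =>
    G.ellInterIncl q ∘ₗ (S t).toLinearMap.restrict (hmem t)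
  have hLn : ∀ (t : ℝ≥0) (f : G.ellInter q),
      ‖L t f‖ ≤ Real.exp (w * t) * ‖G.ellInterIncl q f‖ := fun t f =>
    G.norm_ellInterIncl_le_of_eLpNorm_le (Real.exp_pos _).le (hS t f f.2)
  have hd := G.denseRange_ellInterIncl hp
  let Sp : ℝ≥0 → G.ell q →L[ℂ] G.ell q := fun t => (L t).extendOfNorm (G.ellInterIncl q)
  have hSp : ∀ t f, Sp t (G.ellInterIncl q f) = G.ellInterIncl q ⟨S t f, hmem t f f.2⟩ :=
    fun t f => LinearMap.extendOfNorm_eq hd ⟨_, hLn t⟩ f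
  have hnorm : ∀ t : ℝ≥0, ‖Sp t‖ ≤ Real.exp (w * t) := fun t =>
    LinearMap.opNorm_extendOfNorm_le hd (Real.exp_pos _).le (hLn t)
  have hcons : ∀ (t : ℝ≥0) (f : G.ell 2) (g : G.ell q),
      (f : X → ℂ) = g → (S t f : X → ℂ) = Sp t g := by
    intro t f g hfg
    obtain ⟨hf, rfl⟩ := G.exists_ellInter hfg
    rw [hSp, coeFn_ellInterIncl]
  -- Operators agreeing on the dense subspace ℓ² ∩ ℓ^p coincide; this gives the semigroup law and
  -- the uniqueness.
  have hext : ∀ {T T' : G.ell q →L[ℂ] G.ell q},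
      (∀ f, T (G.ellInterIncl q f) = T' (G.ellInterIncl q f)) → T = T' := fun h =>
    DFunLike.coe_injective (hd.equalizer (ContinuousLinearMap.continuous _)
      (ContinuousLinearMap.continuous _) (funext h))
  have hz : Sp 0 = ContinuousLinearMap.id ℂ (G.ell q) := hext fun f => by
    rw [hSp, ContinuousLinearMap.id_apply]
    congr 1
    exact Subtype.ext (DFunLike.congr_fun h0 (f : G.ell 2))
  have ha : ∀ s t, Sp (s + t) = (Sp s).comp (Sp t) := fun s t => hext fun f => by
    rw [ContinuousLinearMap.comp_apply, hSp, hSp, hSp]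
    congr 1
    exact Subtype.ext (DFunLike.congr_fun (hadd s t) (f : G.ell 2))
  refine ⟨Sp, ⟨⟨hz, ha, continuous_semigroup_of_denseRange hz ha hnorm
    (G.denseRange_toEll hp) fun φ => ?_⟩, hnorm, hcons⟩, ?_⟩
  · refine G.tendsto_toEll_of_pointwise hp (fun x => ?_) (B := fun t : ℝ≥0 => Real.exp (w * t)) ?_
      fun t => (Sp t).le_of_opNorm_le (hnorm t) _
    · have h1 := ((G.continuous_eval x).tendsto _).comp (hcont (G.toEll2 φ))
      rw [coeFn_toEll2] at h1
      refine h1.congr fun t => ?_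
      rw [← hcons t (G.toEll2 φ) _ (by rw [coeFn_toEll2, coeFn_toEll])]
      rfl
    · have : Continuous fun t : ℝ≥0 => Real.exp (w * t) := by fun_prop
      simpa using this.tendsto 0
  · rintro T ⟨-, -, hT⟩
    funext t
    refine hext fun f => G.ell_ext ?_
    rw [← hT t f _ (G.coeFn_ellInterIncl f).symm, ← hcons t f _ (G.coeFn_ellInterIncl f).symm]

end MagneticSchrodingerGraph

end

theorem theorem3p1 {X : Type*} (G : MagneticSchrodingerGraph X) (hG : G.IsPositive)
    (M C : ℝ) (hM : 0 < M) (hC : 0 ≤ C) (hc : G.IsFormBounded M C)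
    (p : ℝ) (hp : p ∈ Set.Icc (2 * ((M + 1) / M) - 2 * (√(M + 1) / M))
      (2 * ((M + 1) / M) + 2 * (√(M + 1) / M))) :
    -- `S₂(t)` maps `ℓ² ∩ ℓ^p` to `ℓ^p` with norm at most `exp (-D_p t)`
    (∀ (t : ℝ≥0) (f : G.ell 2), MemLp f (ENNReal.ofReal p) G.measure →
      MemLp (G.S2 hG t f) (ENNReal.ofReal p) G.measure ∧
      eLpNorm (G.S2 hG t f) (ENNReal.ofReal p) G.measure ≤
        ENNReal.ofReal (Real.exp (-Dconst M C (G.lam2 hG) p * t)) *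
          eLpNorm f (ENNReal.ofReal p) G.measure) ∧
    -- `1 ≤ p`, so that `ℓ^p` is a Banach space, and `S₂` extends consistently to a strongly
    -- continuous semigroup on `ℓ^p`, with the same bound
    ∃ _ : Fact (1 ≤ ENNReal.ofReal p),
      ∃! Sp : ℝ≥0 → G.ell (ENNReal.ofReal p) →L[ℂ] G.ell (ENNReal.ofReal p),
        IsC0Semigroup Sp ∧
        (∀ t, ‖Sp t‖ ≤ Real.exp (-Dconst M C (G.lam2 hG) p * t)) ∧
        ∀ (t : ℝ≥0) (f : G.ell 2) (g : G.ell (ENNReal.ofReal p)),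
          (f : X → ℂ) = g → (G.S2 hG t f : X → ℂ) = Sp t g := by
  obtain ⟨hp1, hM1⟩ := MagneticSchrodingerGraph.Cconst_coeff_nonneg hM hp
  have hbound := fun t f hf => G.eLpNorm_S2_le hG hc hp1 hM1 t f hf
  have hfact : Fact (1 ≤ ENNReal.ofReal p) := ⟨ENNReal.one_le_ofReal.mpr hp1.le⟩
  exact ⟨fun t f hf => ⟨⟨G.aestronglyMeasurable_measure _,
      (hbound t f hf).trans_lt (ENNReal.mul_lt_top ENNReal.ofReal_lt_top hf.2)⟩, hbound t f hf⟩,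
    hfact, G.existsUnique_extension hp1.le (G.S2_zero hG) (G.S2_add hG) (G.tendsto_S2_zero hG)
      hbound⟩
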